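/- **The type theory.** Nullary PTT is the following dependent type theory. Contexts consist of cartesian variables $a:A$, affine bridge variables $x:\mathbb A$, path dimensions $i:\mathrm I$ and cubical constraints $r=s$. If $(x:\mathbb A)\in\Gamma$, then $\Gamma\setminus x$ is $\Gamma$ with $x$ and all cartesian variables to the right of $x$ removed (bridge variables, dimensions and constraints are kept); a term typed in $\Gamma\setminus x$ is called *fresh* for $x$. The theory has * a hierarchy of cumulative universes $\mathcal U$, $\Pi$- and $\Sigma$-types with $\beta\eta$, a unit type $1$ with $\eta$, binary sums with dependent elimination; * the cubical primitives: dependent path types ($\equiv$ is the non-dependent path type), coercion and homogeneous composition with their boundary equations, and the type former $\mathsf V$ turning equivalences into paths of the universe. $A\simeq B$ is the type of functions $A\to B$ with contractible fibers; * bridge types: if $\Gamma,x:\mathbb A\vdash A$ type then $(x:\mathbb A)\multimap A$ is a type, introduced by $\lambda x.a$ and eliminated by $a'\,x$ where $a'$ is typed in $\Gamma\setminus x$, with $\beta$ and $\eta$; * extent: for $\Gamma\setminus x,y:\mathbb A\vdash A$ type, $\Gamma\setminus x,y:\mathbb A,a:A\vdash B$ type, $\Gamma\setminus x,a':(y:\mathbb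 A)\multimap A,y:\mathbb A\vdash b:B[a'y/a]$ and $\Gamma\vdash a_x:A[x/y]$, a term $\mathsf{ext}(\lambda a'y.b)\,x\,a_x:B[x/y,a_x/a]$, with $\mathsf{ext}(\lambda a'y.b)\,x\,(a[x/y])=b[(\lambda y.a)/a',x/y]$ whenever $\Gamma\setminus x,y:\mathbb A\vdash a:A$; * Gel types: for $A$ (resp. $a:A$) typed in $\Gamma\setminus x$, a type $\mathsf{Gel}\,A\,x$ (resp. a term $\mathsf{gel}\,a\,x:\mathsf{Gel}\,A\,x$) in $\Gamma$; for $\Gamma,x:\mathbb A\vdash g:\mathsf{Gel}\,A\,x$ a term $\Gamma\vdash\mathsf{ung}(\lambda x.g):A$; with $\mathsf{ung}(\lambda x.\mathsf{gel}\,a\,x)=a$ and the corresponding $\eta$-rule. Put $\mathsf{forg}\,x\,g:=\mathsf{ext}(\lambda g'y.\mathsf{ung}\,g')\,x\,g$; * a type $\mathsf{Nm}$ with a name $\mathsf c\,x:\mathsf{Nm}$ for every $(x:\mathbb A)\in\Gamma$, and name induction: for $(x:\mathbb A)\in\Gamma$, $n:\mathsf{Nm}$, $z:\mathsf{Nm}\vdash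 B$ type, $b_0:B[\mathsf c\,x/z]$ and $g:\mathsf{Gel}\,\mathsf{Nm}\,x\vdash b_1:B[\mathsf{forg}\,x\,g/z]$, a term $\mathsf{ind}_{\mathsf{Nm}}\,x\,n\,b_0\,(\lambda g.b_1):B[n/z]$, with $\mathsf{ind}_{\mathsf{Nm}}\,x\,(\mathsf c\,x)\,b_0\,(\lambda g.b_1)=b_0$, and $\mathsf{ind}_{\mathsf{Nm}}\,x\,n\,b_0\,(\lambda g.b_1)=b_1[\mathsf{gel}\,n\,x/g]$ if $n$ is typed in $\Gamma\setminus x$. **The maps.** Define closed terms $$\mathsf{loosen}\,(\mathsf{inl}\,\_)=\lambda x.\,\mathsf c\,x,\qquad \mathsf{loosen}\,(\mathsf{inr}\,n)=\lambda\_.\,n,\qquad \mathsf{tighten}\,n'=\mathsf{ung}\,(t_2\,(t_1\,n')),$$ where $t_1\,n'\,x=\mathsf{ind}_{\mathsf{Nm}}\,x\,(n'\,x)\,(\mathsf{inl}\,\star)\,(\lambda g.\,\mathsf{inr}\,g)$, $t_2\,s'\,x=t_2^{\mathrm{pre}}\,x\,(s'\,x)$, $t_2^{\mathrm{pre}}\,x\,(\mathsf{inl}\,\_)=\mathsf{gel}\,(\mathsf{inl}\,\star)\,x$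 and $t_2^{\mathrm{pre}}\,x\,(\mathsf{inr}\,g)=\mathsf{ext}\,(\lambda g'\,y.\,\mathsf{gel}\,(\mathsf{inr}\,(\mathsf{ung}\,g'))\,y)\,x\,g$. **Theorem (Structure Abstraction Principle at $\mathsf{Nm}$).** In the empty context of nullary PTT the following hold. 1. $\mathsf{loosen}:1+\mathsf{Nm}\to(\mathbb A\multimap\mathsf{Nm})$ and $\mathsf{tighten}:(\mathbb A\multimap\mathsf{Nm})\to1+\mathsf{Nm}$ are derivable. 2. $\mathsf{loosen}$ and $\mathsf{tighten}$ are mutually inverse: the types $(s:1+\mathsf{Nm})\to\mathsf{tighten}\,(\mathsf{loosen}\,s)\equiv s$ and $(n':\mathbb A\multimap\mathsf{Nm})\to\mathsf{loosen}\,(\mathsf{tighten}\,n')\equiv n'$ are inhabited. 3. There is an equivalence $1+\mathsf{Nm}\simeq(\mathbb A\multimap\mathsf{Nm})$ with underlying function $\mathsf{loosen}$. 4. Every name-abstracted name is the identity bridge or a constant bridge: the type $(n':\mathbb A\multimap\mathsf{Nm})\to\bigl((\lambda x.\mathsf c\,x)\equiv n'\bigr)+\bigl(\sum_{n:\mathsf{Nm}}(\lambda\_.n)\equiv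 n'\bigr)$ is inhabited. -/

import Mathlib

namespace NullaryPTT

/-! ## Raw syntax

Raw expressions with de Bruijn indices. There is one index space for the three kinds of variables:
cartesian (term) variables, affine bridge variables `x : 𝔸`, and path dimensions `i : I`. -/

inductive Tm : Type
  /-- a cartesian variable, bridge variable or path dimension variable -/
  | var (n : ℕ)
  /-- universes -/
  | univ (l : ℕ)
  /-- dependent function types; `B` binds a variable -/
  | pi (A B : Tm)
  | lam (b : Tm)
  | app (f a : Tm)
  /-- dependent pair types; `B` binds a variable -/
  | sigma (A B : Tm)
  | pair (a b : Tm)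
  | fst (p : Tm)
  | snd (p : Tm)
  /-- the unit type -/
  | unit
  | star
  /-- binary sums; both branches of `case` bind a variable -/
  | sum (A B : Tm)
  | inl (a : Tm)
  | inr (b : Tm)
  | case (s d e : Tm)
  /-- end points of the path interval -/
  | i0
  | i1
  /-- dependent path types; `A` and the body of `plam` bind a path dimension -/
  | path (A a b : Tm)
  | plam (m : Tm)
  | papp (p r : Tm)
  /-- `coe A r s m` is coercion of `m` from `r` to `s` along the line `A` (binding a dimension) -/
  | coe (A r s m : Tm)
  /-- `hcom A r s m k e e' N` is the homogeneous composition in `A`, from `r` to `s`, with cap `m`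
  and the `k` tubes `e j = e' j ↪ N j`; every `N j` binds a dimension -/
  | hcom (A r s m : Tm) (k : ℕ) (e e' N : Fin k → Tm)
  /-- the type former that turns equivalences into paths of the universe -/
  | V (r A B E : Tm)
  | vin (r m n : Tm)
  | vproj (r p f : Tm)
  /-- bridge types `(x : 𝔸) ⊸ A`; `A` and the body of `blam` bind a bridge variable -/
  | bridge (A : Tm)
  | blam (a : Tm)
  | bapp (a x : Tm)
  /-- `extent b x a` is `ext (λ a' y. b) x a`; in `b`, index `0` is `y` and index `1` is `a'` -/
  | extent (b x a : Tm)
  | Gel (A x : Tm)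
  | gel (a x : Tm)
  /-- `ung g` is `ung (λ x. g)`; `g` binds a bridge variable -/
  | ung (g : Tm)
  /-- the type of names -/
  | Nm
  /-- the name `c x` of a bridge variable `x` -/
  | cart (x : Tm)
  /-- name induction `ind x n b₀ (λ g. b₁)`; `b₁` binds a variable -/
  | indNm (x n b₀ b₁ : Tm)

namespace Tm

/-- Lifting of a renaming under a binder. -/
def upr (ρ : ℕ → ℕ) : ℕ → ℕ
  | 0 => 0
  | n + 1 => ρ n + 1

def rename : (ℕ → ℕ) → Tm → Tm
  | ρ, var n => var (ρ n)
  | _, univ l => univ l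
  | ρ, pi A B => pi (rename ρ A) (rename (upr ρ) B)
  | ρ, lam b => lam (rename (upr ρ) b)
  | ρ, app f a => app (rename ρ f) (rename ρ a)
  | ρ, sigma A B => sigma (rename ρ A) (rename (upr ρ) B)
  | ρ, pair a b => pair (rename ρ a) (rename ρ b)
  | ρ, fst p => fst (rename ρ p)
  | ρ, snd p => snd (rename ρ p)
  | _, unit => unit
  | _, star => star
  | ρ, sum A B => sum (rename ρ A) (rename ρ B)
  | ρ, inl a => inl (rename ρ a)
  | ρ, inr b => inr (rename ρ b)
  | ρ, case s d e => case (rename ρ s) (rename (upr ρ) d) (rename (upr ρ) e)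
  | _, i0 => i0
  | _, i1 => i1
  | ρ, path A a b => path (rename (upr ρ) A) (rename ρ a) (rename ρ b)
  | ρ, plam m => plam (rename (upr ρ) m)
  | ρ, papp p r => papp (rename ρ p) (rename ρ r)
  | ρ, coe A r s m => coe (rename (upr ρ) A) (rename ρ r) (rename ρ s) (rename ρ m)
  | ρ, hcom A r s m k e e' N =>
      hcom (rename ρ A) (rename ρ r) (rename ρ s) (rename ρ m) k
        (fun j => rename ρ (e j)) (fun j => rename ρ (e' j)) (fun j => rename (upr ρ) (N j))
  | ρ, V r A B E => V (rename ρ r) (rename ρ A) (rename ρ B) (rename ρ E)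
  | ρ, vin r m n => vin (rename ρ r) (rename ρ m) (rename ρ n)
  | ρ, vproj r p f => vproj (rename ρ r) (rename ρ p) (rename ρ f)
  | ρ, bridge A => bridge (rename (upr ρ) A)
  | ρ, blam a => blam (rename (upr ρ) a)
  | ρ, bapp a x => bapp (rename ρ a) (rename ρ x)
  | ρ, extent b x a => extent (rename (upr (upr ρ)) b) (rename ρ x) (rename ρ a)
  | ρ, Gel A x => Gel (rename ρ A) (rename ρ x)
  | ρ, gel a x => gel (rename ρ a) (rename ρ x)
  | ρ, ung g => ung (rename (upr ρ) g)
  | _, Nm => Nm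
  | ρ, cart x => cart (rename ρ x)
  | ρ, indNm x n b₀ b₁ =>
      indNm (rename ρ x) (rename ρ n) (rename ρ b₀) (rename (upr ρ) b₁)

/-- Weakening by one variable. -/
def shift (t : Tm) : Tm := rename (fun n => n + 1) t

/-- Extension of a substitution: index `0` is sent to `u`. -/
def scons (u : Tm) (σ : ℕ → Tm) : ℕ → Tm
  | 0 => u
  | n + 1 => σ n

/-- Lifting of a substitution under a binder. -/
def ups (σ : ℕ → Tm) : ℕ → Tm := scons (var 0) (fun n => shift (σ n))

/-- Capture-avoiding simultaneous substitution. -/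
def subst : (ℕ → Tm) → Tm → Tm
  | σ, var n => σ n
  | _, univ l => univ l
  | σ, pi A B => pi (subst σ A) (subst (ups σ) B)
  | σ, lam b => lam (subst (ups σ) b)
  | σ, app f a => app (subst σ f) (subst σ a)
  | σ, sigma A B => sigma (subst σ A) (subst (ups σ) B)
  | σ, pair a b => pair (subst σ a) (subst σ b)
  | σ, fst p => fst (subst σ p)
  | σ, snd p => snd (subst σ p)
  | _, unit => unit
  | _, star => star
  | σ, sum A B => sum (subst σ A) (subst σ B)
  | σ, inl a => inl (subst σ a)
  | σ, inr b => inr (subst σ b)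
  | σ, case s d e => case (subst σ s) (subst (ups σ) d) (subst (ups σ) e)
  | _, i0 => i0
  | _, i1 => i1
  | σ, path A a b => path (subst (ups σ) A) (subst σ a) (subst σ b)
  | σ, plam m => plam (subst (ups σ) m)
  | σ, papp p r => papp (subst σ p) (subst σ r)
  | σ, coe A r s m => coe (subst (ups σ) A) (subst σ r) (subst σ s) (subst σ m)
  | σ, hcom A r s m k e e' N =>
      hcom (subst σ A) (subst σ r) (subst σ s) (subst σ m) k
        (fun j => subst σ (e j)) (fun j => subst σ (e' j)) (fun j => subst (ups σ) (N j))
  | σ, V r A B E => V (subst σ r) (subst σ A) (subst σ B) (subst σ E)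
  | σ, vin r m n => vin (subst σ r) (subst σ m) (subst σ n)
  | σ, vproj r p f => vproj (subst σ r) (subst σ p) (subst σ f)
  | σ, bridge A => bridge (subst (ups σ) A)
  | σ, blam a => blam (subst (ups σ) a)
  | σ, bapp a x => bapp (subst σ a) (subst σ x)
  | σ, extent b x a => extent (subst (ups (ups σ)) b) (subst σ x) (subst σ a)
  | σ, Gel A x => Gel (subst σ A) (subst σ x)
  | σ, gel a x => gel (subst σ a) (subst σ x)
  | σ, ung g => ung (subst (ups σ) g)
  | _, Nm => Nm
  | σ, cart x => cart (subst σ x)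
  | σ, indNm x n b₀ b₁ => indNm (subst σ x) (subst σ n) (subst σ b₀) (subst (ups σ) b₁)

/-- `t[u/0]`: substitution of `u` for the last variable, which disappears from the context. -/
def inst (t u : Tm) : Tm := subst (scons u var) t

/-- `t[u/0, v/1]`: substitution for the last two variables. -/
def inst₂ (t u v : Tm) : Tm := subst (scons u (scons v var)) t

/-- `t[u/0]` where `u` lives over a context in which the last variable is replaced by another one
(so index `0` is sent to `u`, the other variables are kept). -/
def repl (t u : Tm) : Tm := subst (scons u (fun n => var (n + 1))) t

/-! ### Derived type formers -/

/-- Non-dependent functions. -/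
def arrow (A B : Tm) : Tm := pi A (shift B)

/-- Non-dependent bridges `𝔸 ⊸ A`. -/
def bridges (A : Tm) : Tm := bridge (shift A)

/-- Non-dependent paths `a ≡ b` in `A`. -/
def eq (A a b : Tm) : Tm := path (shift A) a b

/-- `Σ (c : X), Π (z : X), c ≡ z`. -/
def isContr (X : Tm) : Tm :=
  sigma X (pi (shift X) (eq (shift (shift X)) (var 1) (var 0)))

/-- `Σ (a : A), f a ≡ b`. -/
def fiber (A B f b : Tm) : Tm :=
  sigma A (eq (shift B) (app (shift f) (var 0)) (shift b))

/-- `Π (b : B), isContr (fiber f b)`. -/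
def isEquiv (A B f : Tm) : Tm :=
  pi B (isContr (fiber (shift A) (shift B) (shift f) (var 0)))

/-- `A ≃ B`: functions with contractible fibers. -/
def equiv (A B : Tm) : Tm :=
  sigma (arrow A B) (isEquiv (shift A) (shift B) (var 0))

/-- `forg x g := ext (λ g' y. ung g') x g`. -/
def forg (x g : Tm) : Tm := extent (ung (bapp (var 2) (var 0))) x g

end Tm

open Tm

/-! ## Contexts -/

/-- Entries of a context: a cartesian variable, a bridge variable, a path dimension, or the place of
a variable that has been removed. A removed variable keeps its index but no rule lets one use it, so
that judgements over a context with removed entries are, up to renumbering the variables, the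
judgements over the context from which these entries have been deleted. -/
inductive Entry : Type
  | tm (A : Tm)
  | name
  | dim
  | removed

/-- A context: its variables (the most recent one first) and its cubical constraints `r = s`. -/
structure Ctx where
  vars : List Entry
  cofs : List (Tm × Tm)

namespace Ctx

def empty : Ctx := ⟨[], []⟩

/-- Extension by an entry. -/
def snoc (Γ : Ctx) (e : Entry) : Ctx :=
  ⟨e :: Γ.vars, Γ.cofs.map fun c => (shift c.1, shift c.2)⟩

/-- `Γ, a : A` -/
def tm (Γ : Ctx) (A : Tm) : Ctx := Γ.snoc (.tm A)

/-- `Γ, x : 𝔸` -/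
def name (Γ : Ctx) : Ctx := Γ.snoc .name

/-- `Γ, i : I` -/
def dim (Γ : Ctx) : Ctx := Γ.snoc .dim

/-- `Γ, r = s` -/
def cof (Γ : Ctx) (r s : Tm) : Ctx := ⟨Γ.vars, (r, s) :: Γ.cofs⟩

def restrVars : List Entry → ℕ → List Entry
  | [], _ => []
  | _ :: Γ, 0 => .removed :: Γ
  | .tm _ :: Γ, x + 1 => .removed :: restrVars Γ x
  | e :: Γ, x + 1 => e :: restrVars Γ x

/-- The restriction `Γ ∖ x`: the bridge variable `x` and all cartesian variables to the right of `x`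
are removed; bridge variables, path dimensions and constraints are kept. -/
def restr (Γ : Ctx) (x : ℕ) : Ctx := ⟨restrVars Γ.vars x, Γ.cofs⟩

/-- `(x : 𝔸) ∈ Γ` -/
def IsName (Γ : Ctx) (x : ℕ) : Prop := Γ.vars[x]? = some .name

end Ctx

/-- `Γ ⊢ r : I` -/
inductive IsDim (Γ : Ctx) : Tm → Prop
  | i0 : IsDim Γ i0
  | i1 : IsDim Γ i1
  | var {n : ℕ} : Γ.vars[n]? = some .dim → IsDim Γ (var n)

/-- `Γ ⊢ r = s : I`, generated by the constraints of `Γ`. -/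
inductive EqDim (Γ : Ctx) : Tm → Tm → Prop
  | hyp {r s : Tm} : (r, s) ∈ Γ.cofs → EqDim Γ r s
  | refl {r : Tm} : IsDim Γ r → EqDim Γ r r
  | symm {r s : Tm} : EqDim Γ r s → EqDim Γ s r
  | trans {r s t : Tm} : EqDim Γ r s → EqDim Γ s t → EqDim Γ r t

/-! ## Judgements and rules

Universes are cumulative and à la Russell; `Γ ⊢ A type` is `Γ ⊢ A : univ l` for some `l`. -/

mutual

/-- `Γ ctx` -/
inductive Wf : Ctx → Prop
  | empty : Wf Ctx.empty
  | tm {Γ : Ctx} {A : Tm} {l : ℕ} : Wf Γ → HasTy Γ A (univ l) → Wf (Γ.tm A)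
  | name {Γ : Ctx} : Wf Γ → Wf Γ.name
  | dim {Γ : Ctx} : Wf Γ → Wf Γ.dim
  | removed {Γ : Ctx} : Wf Γ → Wf (Γ.snoc .removed)
  | cof {Γ : Ctx} {r s : Tm} : Wf Γ → IsDim Γ r → IsDim Γ s → Wf (Γ.cof r s)

/-- `Γ ⊢ a : A` -/
inductive HasTy : Ctx → Tm → Tm → Prop
  -- structural rules and universes
  | var {Γ : Ctx} {n : ℕ} {A : Tm} : Wf Γ → Γ.vars[n]? = some (.tm A) →
      HasTy Γ (var n) (rename (fun m => m + (n + 1)) A)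
  | conv {Γ : Ctx} {a A B : Tm} {l : ℕ} : HasTy Γ a A → EqTm Γ A B (univ l) → HasTy Γ a B
  | univ {Γ : Ctx} {l : ℕ} : Wf Γ → HasTy Γ (univ l) (univ (l + 1))
  | cumul {Γ : Ctx} {A : Tm} {l : ℕ} : HasTy Γ A (univ l) → HasTy Γ A (univ (l + 1))
  -- dependent functions
  | pi {Γ : Ctx} {A B : Tm} {l : ℕ} : HasTy Γ A (univ l) → HasTy (Γ.tm A) B (univ l) →
      HasTy Γ (pi A B) (univ l)
  | lam {Γ : Ctx} {A B b : Tm} {l : ℕ} : HasTy Γ A (univ l) → HasTy (Γ.tm A) b B →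
      HasTy Γ (lam b) (pi A B)
  | app {Γ : Ctx} {A B f a : Tm} : HasTy Γ f (pi A B) → HasTy Γ a A →
      HasTy Γ (app f a) (B.inst a)
  -- dependent pairs
  | sigma {Γ : Ctx} {A B : Tm} {l : ℕ} : HasTy Γ A (univ l) → HasTy (Γ.tm A) B (univ l) →
      HasTy Γ (sigma A B) (univ l)
  | pair {Γ : Ctx} {A B a b : Tm} {l : ℕ} : HasTy Γ A (univ l) → HasTy (Γ.tm A) B (univ l) →
      HasTy Γ a A → HasTy Γ b (B.inst a) → HasTy Γ (pair a b) (sigma A B)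
  | fst {Γ : Ctx} {A B p : Tm} : HasTy Γ p (sigma A B) → HasTy Γ (fst p) A
  | snd {Γ : Ctx} {A B p : Tm} : HasTy Γ p (sigma A B) → HasTy Γ (snd p) (B.inst (fst p))
  -- unit type
  | unit {Γ : Ctx} {l : ℕ} : Wf Γ → HasTy Γ unit (univ l)
  | star {Γ : Ctx} : Wf Γ → HasTy Γ star unit
  -- sums
  | sum {Γ : Ctx} {A B : Tm} {l : ℕ} : HasTy Γ A (univ l) → HasTy Γ B (univ l) →
      HasTy Γ (sum A B) (univ l)
  | inl {Γ : Ctx} {A B a : Tm} {l : ℕ} : HasTy Γ a A → HasTy Γ B (univ l) →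
      HasTy Γ (inl a) (sum A B)
  | inr {Γ : Ctx} {A B b : Tm} {l : ℕ} : HasTy Γ A (univ l) → HasTy Γ b B →
      HasTy Γ (inr b) (sum A B)
  | case {Γ : Ctx} {A B C s d e : Tm} {l : ℕ} : HasTy Γ s (sum A B) →
      HasTy (Γ.tm (sum A B)) C (univ l) →
      HasTy (Γ.tm A) d (C.repl (inl (var 0))) → HasTy (Γ.tm B) e (C.repl (inr (var 0))) →
      HasTy Γ (case s d e) (C.inst s)
  -- paths
  | path {Γ : Ctx} {A a b : Tm} {l : ℕ} : HasTy Γ.dim A (univ l) →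
      HasTy Γ a (A.inst i0) → HasTy Γ b (A.inst i1) → HasTy Γ (path A a b) (univ l)
  | plam {Γ : Ctx} {A a b m : Tm} : HasTy Γ.dim m A →
      EqTm Γ (m.inst i0) a (A.inst i0) → EqTm Γ (m.inst i1) b (A.inst i1) →
      HasTy Γ (plam m) (path A a b)
  | papp {Γ : Ctx} {A a b p r : Tm} : HasTy Γ p (path A a b) → IsDim Γ r →
      HasTy Γ (papp p r) (A.inst r)
  -- Kan operations
  | coe {Γ : Ctx} {A r s m : Tm} {l : ℕ} : HasTy Γ.dim A (univ l) → IsDim Γ r → IsDim Γ s →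
      HasTy Γ m (A.inst r) → HasTy Γ (coe A r s m) (A.inst s)
  | hcom {Γ : Ctx} {A r s m : Tm} {l k : ℕ} {e e' N : Fin k → Tm} : HasTy Γ A (univ l) →
      IsDim Γ r → IsDim Γ s → HasTy Γ m A →
      (∀ j, IsDim Γ (e j)) → (∀ j, IsDim Γ (e' j)) →
      (∀ j, HasTy (Γ.cof (e j) (e' j)).dim (N j) A.shift) →
      (∀ j, EqTm (Γ.cof (e j) (e' j)) ((N j).inst r) m A) →
      (∀ j j', EqTm ((Γ.cof (e j) (e' j)).cof (e j') (e' j')).dim (N j) (N j') A.shift) →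
      HasTy Γ (hcom A r s m k e e' N) A
  -- univalence
  | V {Γ : Ctx} {r A B E : Tm} {l : ℕ} : IsDim Γ r → HasTy (Γ.cof r i0) A (univ l) →
      HasTy Γ B (univ l) → HasTy (Γ.cof r i0) E (equiv A B) → HasTy Γ (V r A B E) (univ l)
  | vin {Γ : Ctx} {r A B E m n : Tm} {l : ℕ} : HasTy Γ (V r A B E) (univ l) →
      HasTy (Γ.cof r i0) m A → HasTy Γ n B → EqTm (Γ.cof r i0) (app (fst E) m) n B →
      HasTy Γ (vin r m n) (V r A B E)
  | vproj {Γ : Ctx} {r A B E p f : Tm} : HasTy Γ p (V r A B E) →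
      EqTm (Γ.cof r i0) f (fst E) (arrow A B) → HasTy Γ (vproj r p f) B
  -- bridges
  | bridge {Γ : Ctx} {A : Tm} {l : ℕ} : HasTy Γ.name A (univ l) → HasTy Γ (bridge A) (univ l)
  | blam {Γ : Ctx} {A a : Tm} : HasTy Γ.name a A → HasTy Γ (blam a) (bridge A)
  | bapp {Γ : Ctx} {A a : Tm} {x : ℕ} : Wf Γ → Γ.IsName x → HasTy (Γ.restr x) a (bridge A) →
      HasTy Γ (bapp a (var x)) (A.inst (var x))
  -- extent
  | extent {Γ : Ctx} {A B b a : Tm} {x l : ℕ} : Γ.IsName x →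
      HasTy (Γ.restr x).name A (univ l) → HasTy ((Γ.restr x).name.tm A) B (univ l) →
      HasTy ((Γ.restr x).tm (bridge A)).name b
        (B.subst (scons (bapp (var 1) (var 0)) (scons (var 0) fun n => var (n + 2)))) →
      HasTy Γ a (A.inst (var x)) → HasTy Γ (extent b (var x) a) (B.inst₂ a (var x))
  -- Gel types
  | Gel {Γ : Ctx} {A : Tm} {x l : ℕ} : Wf Γ → Γ.IsName x → HasTy (Γ.restr x) A (univ l) →
      HasTy Γ (Gel A (var x)) (univ l)
  | gel {Γ : Ctx} {A a : Tm} {x : ℕ} : Wf Γ → Γ.IsName x → HasTy (Γ.restr x) a A →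
      HasTy Γ (gel a (var x)) (Gel A (var x))
  | ung {Γ : Ctx} {A g : Tm} : HasTy Γ.name g (Gel A.shift (var 0)) → HasTy Γ (ung g) A
  -- names
  | Nm {Γ : Ctx} {l : ℕ} : Wf Γ → HasTy Γ Nm (univ l)
  | cart {Γ : Ctx} {x : ℕ} : Wf Γ → Γ.IsName x → HasTy Γ (cart (var x)) Nm
  | indNm {Γ : Ctx} {B n b₀ b₁ : Tm} {x l : ℕ} : Γ.IsName x → HasTy Γ n Nm →
      HasTy (Γ.tm Nm) B (univ l) → HasTy Γ b₀ (B.inst (cart (var x))) →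
      HasTy (Γ.tm (Gel Nm (var x))) b₁ (B.repl (forg (var (x + 1)) (var 0))) →
      HasTy Γ (indNm (var x) n b₀ b₁) (B.inst n)

/-- `Γ ⊢ a = b : A` -/
inductive EqTm : Ctx → Tm → Tm → Tm → Prop
  -- equivalence relation, conversion, inconsistent constraints
  | refl {Γ : Ctx} {a A : Tm} : HasTy Γ a A → EqTm Γ a a A
  | symm {Γ : Ctx} {a b A : Tm} : EqTm Γ a b A → EqTm Γ b a A
  | trans {Γ : Ctx} {a b c A : Tm} : EqTm Γ a b A → EqTm Γ b c A → EqTm Γ a c A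
  | conv {Γ : Ctx} {a b A B : Tm} {l : ℕ} : EqTm Γ a b A → EqTm Γ A B (univ l) → EqTm Γ a b B
  | cumul {Γ : Ctx} {A B : Tm} {l : ℕ} : EqTm Γ A B (univ l) → EqTm Γ A B (univ (l + 1))
  | absurd {Γ : Ctx} {a b A : Tm} : EqDim Γ i0 i1 → HasTy Γ a A → HasTy Γ b A → EqTm Γ a b A
  -- dependent functions
  | pi {Γ : Ctx} {A A' B B' : Tm} {l : ℕ} : HasTy Γ A (univ l) → EqTm Γ A A' (univ l) →
      EqTm (Γ.tm A) B B' (univ l) → EqTm Γ (pi A B) (pi A' B') (univ l)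
  | lam {Γ : Ctx} {A B b b' : Tm} {l : ℕ} : HasTy Γ A (univ l) → EqTm (Γ.tm A) b b' B →
      EqTm Γ (lam b) (lam b') (pi A B)
  | app {Γ : Ctx} {A B f f' a a' : Tm} : EqTm Γ f f' (pi A B) → EqTm Γ a a' A →
      EqTm Γ (app f a) (app f' a') (B.inst a)
  | pi_beta {Γ : Ctx} {A B b a : Tm} : HasTy (Γ.tm A) b B → HasTy Γ a A →
      EqTm Γ (app (lam b) a) (b.inst a) (B.inst a)
  | pi_eta {Γ : Ctx} {A B f f' : Tm} : HasTy Γ f (pi A B) → HasTy Γ f' (pi A B) →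
      EqTm (Γ.tm A) (app f.shift (var 0)) (app f'.shift (var 0)) B → EqTm Γ f f' (pi A B)
  -- dependent pairs
  | sigma {Γ : Ctx} {A A' B B' : Tm} {l : ℕ} : HasTy Γ A (univ l) → EqTm Γ A A' (univ l) →
      EqTm (Γ.tm A) B B' (univ l) → EqTm Γ (sigma A B) (sigma A' B') (univ l)
  | pair {Γ : Ctx} {A B a a' b b' : Tm} {l : ℕ} : HasTy Γ A (univ l) →
      HasTy (Γ.tm A) B (univ l) → EqTm Γ a a' A → EqTm Γ b b' (B.inst a) →
      EqTm Γ (pair a b) (pair a' b') (sigma A B)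
  | fst {Γ : Ctx} {A B p p' : Tm} : EqTm Γ p p' (sigma A B) → EqTm Γ (fst p) (fst p') A
  | snd {Γ : Ctx} {A B p p' : Tm} : EqTm Γ p p' (sigma A B) →
      EqTm Γ (snd p) (snd p') (B.inst (fst p))
  | fst_beta {Γ : Ctx} {A B a b : Tm} {l : ℕ} : HasTy (Γ.tm A) B (univ l) → HasTy Γ a A →
      HasTy Γ b (B.inst a) → EqTm Γ (fst (pair a b)) a A
  | snd_beta {Γ : Ctx} {A B a b : Tm} {l : ℕ} : HasTy (Γ.tm A) B (univ l) → HasTy Γ a A →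
      HasTy Γ b (B.inst a) → EqTm Γ (snd (pair a b)) b (B.inst a)
  | sigma_eta {Γ : Ctx} {A B p p' : Tm} : HasTy Γ p (sigma A B) → HasTy Γ p' (sigma A B) →
      EqTm Γ (fst p) (fst p') A → EqTm Γ (snd p) (snd p') (B.inst (fst p)) →
      EqTm Γ p p' (sigma A B)
  -- unit type
  | unit_eta {Γ : Ctx} {a : Tm} : HasTy Γ a unit → EqTm Γ a star unit
  -- sums
  | sum {Γ : Ctx} {A A' B B' : Tm} {l : ℕ} : EqTm Γ A A' (univ l) → EqTm Γ B B' (univ l) →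
      EqTm Γ (sum A B) (sum A' B') (univ l)
  | inl {Γ : Ctx} {A B a a' : Tm} {l : ℕ} : EqTm Γ a a' A → HasTy Γ B (univ l) →
      EqTm Γ (inl a) (inl a') (sum A B)
  | inr {Γ : Ctx} {A B b b' : Tm} {l : ℕ} : HasTy Γ A (univ l) → EqTm Γ b b' B →
      EqTm Γ (inr b) (inr b') (sum A B)
  | case {Γ : Ctx} {A B C s s' d d' e e' : Tm} {l : ℕ} : EqTm Γ s s' (sum A B) →
      HasTy (Γ.tm (sum A B)) C (univ l) →
      EqTm (Γ.tm A) d d' (C.repl (inl (var 0))) → EqTm (Γ.tm B) e e' (C.repl (inr (var 0))) →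
      EqTm Γ (case s d e) (case s' d' e') (C.inst s)
  | case_inl {Γ : Ctx} {A B C a d e : Tm} {l : ℕ} : HasTy Γ a A →
      HasTy (Γ.tm (sum A B)) C (univ l) →
      HasTy (Γ.tm A) d (C.repl (inl (var 0))) → HasTy (Γ.tm B) e (C.repl (inr (var 0))) →
      EqTm Γ (case (inl a) d e) (d.inst a) (C.inst (inl a))
  | case_inr {Γ : Ctx} {A B C b d e : Tm} {l : ℕ} : HasTy Γ b B →
      HasTy (Γ.tm (sum A B)) C (univ l) →
      HasTy (Γ.tm A) d (C.repl (inl (var 0))) → HasTy (Γ.tm B) e (C.repl (inr (var 0))) →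
      EqTm Γ (case (inr b) d e) (e.inst b) (C.inst (inr b))
  -- paths
  | path {Γ : Ctx} {A A' a a' b b' : Tm} {l : ℕ} : EqTm Γ.dim A A' (univ l) →
      EqTm Γ a a' (A.inst i0) → EqTm Γ b b' (A.inst i1) →
      EqTm Γ (path A a b) (path A' a' b') (univ l)
  | plam {Γ : Ctx} {A a b m m' : Tm} : EqTm Γ.dim m m' A →
      EqTm Γ (m.inst i0) a (A.inst i0) → EqTm Γ (m.inst i1) b (A.inst i1) →
      EqTm Γ (plam m) (plam m') (path A a b)
  | papp {Γ : Ctx} {A a b p p' r r' : Tm} : EqTm Γ p p' (path A a b) → IsDim Γ r →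
      IsDim Γ r' → EqDim Γ r r' → EqTm Γ (papp p r) (papp p' r') (A.inst r)
  | papp_i0 {Γ : Ctx} {A a b p : Tm} : HasTy Γ p (path A a b) →
      EqTm Γ (papp p i0) a (A.inst i0)
  | papp_i1 {Γ : Ctx} {A a b p : Tm} : HasTy Γ p (path A a b) →
      EqTm Γ (papp p i1) b (A.inst i1)
  | path_beta {Γ : Ctx} {A m r : Tm} : HasTy Γ.dim m A → IsDim Γ r →
      EqTm Γ (papp (plam m) r) (m.inst r) (A.inst r)
  | path_eta {Γ : Ctx} {A a b p p' : Tm} : HasTy Γ p (path A a b) → HasTy Γ p' (path A a b) →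
      EqTm Γ.dim (papp p.shift (var 0)) (papp p'.shift (var 0)) A → EqTm Γ p p' (path A a b)
  -- Kan operations
  | coe {Γ : Ctx} {A A' r r' s s' m m' : Tm} {l : ℕ} : EqTm Γ.dim A A' (univ l) →
      IsDim Γ r → IsDim Γ r' → EqDim Γ r r' → IsDim Γ s → IsDim Γ s' → EqDim Γ s s' →
      EqTm Γ m m' (A.inst r) → EqTm Γ (coe A r s m) (coe A' r' s' m') (A.inst s)
  | coe_refl {Γ : Ctx} {A r s m : Tm} : HasTy Γ (coe A r s m) (A.inst s) → EqDim Γ r s →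
      EqTm Γ (coe A r s m) m (A.inst s)
  | hcom {Γ : Ctx} {A A' r r' s s' m m' : Tm} {l k : ℕ} {e₁ e₁' N e₂ e₂' N' : Fin k → Tm} :
      HasTy Γ (hcom A r s m k e₁ e₁' N) A → HasTy Γ (hcom A' r' s' m' k e₂ e₂' N') A' →
      EqTm Γ A A' (univ l) → EqDim Γ r r' → EqDim Γ s s' → EqTm Γ m m' A →
      (∀ j, EqDim Γ (e₁ j) (e₂ j)) → (∀ j, EqDim Γ (e₁' j) (e₂' j)) →
      (∀ j, EqTm (Γ.cof (e₁ j) (e₁' j)).dim (N j) (N' j) A.shift) →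
      EqTm Γ (hcom A r s m k e₁ e₁' N) (hcom A' r' s' m' k e₂ e₂' N') A
  | hcom_refl {Γ : Ctx} {A r s m : Tm} {k : ℕ} {e e' N : Fin k → Tm} :
      HasTy Γ (hcom A r s m k e e' N) A → EqDim Γ r s →
      EqTm Γ (hcom A r s m k e e' N) m A
  | hcom_tube {Γ : Ctx} {A r s m : Tm} {k : ℕ} {e e' N : Fin k → Tm} (j : Fin k) :
      HasTy Γ (hcom A r s m k e e' N) A → EqDim Γ (e j) (e' j) →
      EqTm Γ (hcom A r s m k e e' N) ((N j).inst s) A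
  -- univalence
  | V {Γ : Ctx} {r r' A A' B B' E E' : Tm} {l : ℕ} : IsDim Γ r → IsDim Γ r' → EqDim Γ r r' →
      EqTm (Γ.cof r i0) A A' (univ l) → EqTm Γ B B' (univ l) →
      EqTm (Γ.cof r i0) E E' (equiv A B) → EqTm Γ (V r A B E) (V r' A' B' E') (univ l)
  | V_i0 {Γ : Ctx} {r A B E : Tm} {l : ℕ} : HasTy Γ (V r A B E) (univ l) → EqDim Γ r i0 →
      EqTm Γ (V r A B E) A (univ l)
  | V_i1 {Γ : Ctx} {r A B E : Tm} {l : ℕ} : HasTy Γ (V r A B E) (univ l) → EqDim Γ r i1 →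
      EqTm Γ (V r A B E) B (univ l)
  | vin {Γ : Ctx} {r r' A B E m m' n n' : Tm} {l : ℕ} : HasTy Γ (V r A B E) (univ l) →
      IsDim Γ r' → EqDim Γ r r' → EqTm (Γ.cof r i0) m m' A → EqTm Γ n n' B →
      EqTm (Γ.cof r i0) (app (fst E) m) n B → EqTm Γ (vin r m n) (vin r' m' n') (V r A B E)
  | vin_i0 {Γ : Ctx} {r A B E m n : Tm} {l : ℕ} : HasTy Γ (V r A B E) (univ l) →
      HasTy (Γ.cof r i0) m A → HasTy Γ n B → EqTm (Γ.cof r i0) (app (fst E) m) n B →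
      EqDim Γ r i0 → EqTm Γ (vin r m n) m (V r A B E)
  | vin_i1 {Γ : Ctx} {r A B E m n : Tm} {l : ℕ} : HasTy Γ (V r A B E) (univ l) →
      HasTy (Γ.cof r i0) m A → HasTy Γ n B → EqTm (Γ.cof r i0) (app (fst E) m) n B →
      EqDim Γ r i1 → EqTm Γ (vin r m n) n (V r A B E)
  | vproj {Γ : Ctx} {r r' A B E p p' f f' : Tm} : EqTm Γ p p' (V r A B E) →
      IsDim Γ r' → EqDim Γ r r' → EqTm (Γ.cof r i0) f (fst E) (arrow A B) →
      EqTm (Γ.cof r i0) f' (fst E) (arrow A B) → EqTm Γ (vproj r p f) (vproj r' p' f') B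
  | vproj_i0 {Γ : Ctx} {r A B E p f : Tm} : HasTy Γ p (V r A B E) →
      EqTm (Γ.cof r i0) f (fst E) (arrow A B) → EqDim Γ r i0 →
      EqTm Γ (vproj r p f) (app f p) B
  | vproj_i1 {Γ : Ctx} {r A B E p f : Tm} : HasTy Γ p (V r A B E) →
      EqTm (Γ.cof r i0) f (fst E) (arrow A B) → EqDim Γ r i1 → EqTm Γ (vproj r p f) p B
  | V_beta {Γ : Ctx} {r A B E m n f : Tm} {l : ℕ} : HasTy Γ (V r A B E) (univ l) →
      HasTy (Γ.cof r i0) m A → HasTy Γ n B → EqTm (Γ.cof r i0) (app (fst E) m) n B →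
      EqTm (Γ.cof r i0) f (fst E) (arrow A B) → EqTm Γ (vproj r (vin r m n) f) n B
  | V_eta {Γ : Ctx} {r A B E p f : Tm} : HasTy Γ p (V r A B E) →
      EqTm (Γ.cof r i0) f (fst E) (arrow A B) →
      EqTm Γ (vin r p (vproj r p f)) p (V r A B E)
  -- bridges
  | bridge {Γ : Ctx} {A A' : Tm} {l : ℕ} : EqTm Γ.name A A' (univ l) →
      EqTm Γ (bridge A) (bridge A') (univ l)
  | blam {Γ : Ctx} {A a a' : Tm} : EqTm Γ.name a a' A → EqTm Γ (blam a) (blam a') (bridge A)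
  | bapp {Γ : Ctx} {A a a' : Tm} {x : ℕ} : Wf Γ → Γ.IsName x →
      EqTm (Γ.restr x) a a' (bridge A) →
      EqTm Γ (bapp a (var x)) (bapp a' (var x)) (A.inst (var x))
  | bridge_beta {Γ : Ctx} {A a : Tm} {x : ℕ} : Wf Γ → Γ.IsName x →
      HasTy (Γ.restr x).name a A →
      EqTm Γ (bapp (blam a) (var x)) (a.inst (var x)) (A.inst (var x))
  | bridge_eta {Γ : Ctx} {A a a' : Tm} : HasTy Γ a (bridge A) → HasTy Γ a' (bridge A) →
      EqTm Γ.name (bapp a.shift (var 0)) (bapp a'.shift (var 0)) A → EqTm Γ a a' (bridge A)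
  -- extent
  | extent {Γ : Ctx} {A B b b' a a' : Tm} {x l : ℕ} : Γ.IsName x →
      HasTy (Γ.restr x).name A (univ l) → HasTy ((Γ.restr x).name.tm A) B (univ l) →
      EqTm ((Γ.restr x).tm (bridge A)).name b b'
        (B.subst (scons (bapp (var 1) (var 0)) (scons (var 0) fun n => var (n + 2)))) →
      EqTm Γ a a' (A.inst (var x)) →
      EqTm Γ (extent b (var x) a) (extent b' (var x) a') (B.inst₂ a (var x))
  | extent_beta {Γ : Ctx} {A B b a : Tm} {x l : ℕ} : Wf Γ → Γ.IsName x →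
      HasTy (Γ.restr x).name A (univ l) → HasTy ((Γ.restr x).name.tm A) B (univ l) →
      HasTy ((Γ.restr x).tm (bridge A)).name b
        (B.subst (scons (bapp (var 1) (var 0)) (scons (var 0) fun n => var (n + 2)))) →
      HasTy (Γ.restr x).name a A →
      EqTm Γ (extent b (var x) (a.inst (var x))) (b.inst₂ (var x) (blam a))
        (B.inst₂ (a.inst (var x)) (var x))
  -- Gel types
  | Gel {Γ : Ctx} {A A' : Tm} {x l : ℕ} : Wf Γ → Γ.IsName x →
      EqTm (Γ.restr x) A A' (univ l) → EqTm Γ (Gel A (var x)) (Gel A' (var x)) (univ l)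
  | gel {Γ : Ctx} {A a a' : Tm} {x : ℕ} : Wf Γ → Γ.IsName x → EqTm (Γ.restr x) a a' A →
      EqTm Γ (gel a (var x)) (gel a' (var x)) (Gel A (var x))
  | ung {Γ : Ctx} {A g g' : Tm} : EqTm Γ.name g g' (Gel A.shift (var 0)) →
      EqTm Γ (ung g) (ung g') A
  | Gel_beta {Γ : Ctx} {A a : Tm} : HasTy Γ a A → EqTm Γ (ung (gel a.shift (var 0))) a A
  | Gel_eta {Γ : Ctx} {A g g' : Tm} {x l : ℕ} : Wf Γ → Γ.IsName x →
      HasTy (Γ.restr x) A (univ l) → HasTy (Γ.restr x).name g (Gel A.shift (var 0)) →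
      HasTy (Γ.restr x).name g' (Gel A.shift (var 0)) →
      EqTm (Γ.restr x) (ung g) (ung g') A →
      EqTm Γ (g.inst (var x)) (g'.inst (var x)) (Gel A (var x))
  -- names
  | indNm {Γ : Ctx} {B n n' b₀ b₀' b₁ b₁' : Tm} {x l : ℕ} : Γ.IsName x → EqTm Γ n n' Nm →
      HasTy (Γ.tm Nm) B (univ l) → EqTm Γ b₀ b₀' (B.inst (cart (var x))) →
      EqTm (Γ.tm (Gel Nm (var x))) b₁ b₁' (B.repl (forg (var (x + 1)) (var 0))) →
      EqTm Γ (indNm (var x) n b₀ b₁) (indNm (var x) n' b₀' b₁') (B.inst n)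
  | Nm_beta₀ {Γ : Ctx} {B b₀ b₁ : Tm} {x l : ℕ} : Γ.IsName x →
      HasTy (Γ.tm Nm) B (univ l) → HasTy Γ b₀ (B.inst (cart (var x))) →
      HasTy (Γ.tm (Gel Nm (var x))) b₁ (B.repl (forg (var (x + 1)) (var 0))) →
      EqTm Γ (indNm (var x) (cart (var x)) b₀ b₁) b₀ (B.inst (cart (var x)))
  | Nm_beta₁ {Γ : Ctx} {B n b₀ b₁ : Tm} {x l : ℕ} : Γ.IsName x →
      HasTy (Γ.tm Nm) B (univ l) → HasTy Γ b₀ (B.inst (cart (var x))) →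
      HasTy (Γ.tm (Gel Nm (var x))) b₁ (B.repl (forg (var (x + 1)) (var 0))) →
      HasTy (Γ.restr x) n Nm →
      EqTm Γ (indNm (var x) n b₀ b₁) (b₁.inst (gel n (var x))) (B.inst n)

end

/-! ## The maps between `1 + Nm` and `𝔸 ⊸ Nm` -/

/-- `1 + Nm` -/
def onePlusNm : Tm := sum unit Nm

/-- `𝔸 ⊸ Nm` -/
def bridgeNm : Tm := bridges Nm

/-- `loosen (inl _) = λ x. c x`, `loosen (inr n) = λ _. n`. -/
def loosen : Tm := lam (case (var 0) (blam (cart (var 0))) (blam (var 1)))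

/-- `t1 n' x = ind x (n' x) (inl ⋆) (λ g. inr g)`. -/
def t1 : Tm :=
  lam (blam (indNm (var 0) (bapp (var 1) (var 0)) (inl star) (inr (var 0))))

/-- `t2pre x (inl _) = gel (inl ⋆) x`,
`t2pre x (inr g) = ext (λ g' y. gel (inr (ung g')) y) x g`. -/
def t2pre : Tm :=
  blam (lam (case (var 0) (gel (inl star) (var 2))
    (extent (gel (inr (ung (bapp (var 2) (var 0)))) (var 0)) (var 2) (var 0))))

/-- `t2 = λ s' x. t2pre x (s' x)`. -/
def t2 : Tm := lam (blam (app (bapp t2pre (var 0)) (bapp (var 1) (var 0))))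

/-- `tighten n' = ung (t2 (t1 n'))`. -/
def tighten : Tm := lam (ung (bapp (app t2 (app t1 (var 1))) (var 0)))

end NullaryPTT

/-!
The theorem asserts that certain types of the object theory are inhabited, so its proof consists of
explicit terms together with their typing derivations. Every closed term is typed in an arbitrary
well-formed context `Γ`, so no weakening theorem is needed to use it below binders; where an open
term has to be moved to a larger context, the few weakenings that occur are hypotheses
(`WkTy`, `Base`) which are checked on the terms that matter, mostly variables.

*The round trip on bridges.* At a fixed bridge variable `x`, the body of `tighten` is a function
`tightenAt x : Nm → Gel (1 + Nm) x`, and the body of `loosen` extends to a function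
`loosenAt x : Gel (1 + Nm) x → Nm`, defined by `ext`, with
`loosenAt x (h x) = loosen (ung h) x`. Hence the composite `roundTrip x` satisfies
`roundTrip x (n' x) = loosen (tighten n') x` (`blam_roundTrip`). Unlike the right hand side, the
left hand side makes sense for an arbitrary `m : Nm` in place of `n' x`, and this turns the claim
into one that name induction can prove: `namePath x m : roundTrip x m ≡ m`. If `m = c x`, both
sides agree judgmentally. If `m = forg x g`, an appeal to `ext` reduces to the case in which
`forg x g` is fresh for `x`, and again both sides agree judgmentally. Abstracting `x` gives
`counit : Π n', loosen (tighten n') ≡ n'` (`counit_type`).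

*The round trip on `1 + Nm`.* Both `tighten (loosen (inl u))` and `tighten (loosen (inr n))` compute
(`tighten_loosen_inl`, `tighten_loosen_inr`), so case analysis and constant paths suffice.

*Dichotomy.* Case analysis on `tighten n'`, transported along `counit n'` (`decomp_type`).

*Contractible fibers.* Not only `tighten` but also `counit` computes on the values of `loosen`: it
is the constant path there (`counit_blam_cart`, `counit_blam_var`). Thus in the fiber over
`loosen s` the point `(tighten (loosen s), counit (loosen s))` is `(s, refl)`, judgmentally once `s`
is a variable under `inl` or `inr` (`contrRefl_type`). For a general point `(s, p)` of the fiber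
over `b`, this path is transported along `p : loosen s ≡ b`. The transport needs the partial paths
`loosen s ≡ p i`, that is a connection, which is constructed from two homogeneous compositions
(`conn_type`, `contr_type`).
-/

namespace NullaryPTT
open Tm Ctx

variable {Γ : Ctx} {x : ℕ}

/-! ### Renaming and substitution -/

namespace Tm

theorem ups_var : ups var = var := by
  funext n; cases n <;> rfl

theorem ups_comp_upr (σ : ℕ → Tm) (ρ : ℕ → ℕ) :
    (fun n => ups σ (upr ρ n)) = ups (fun n => σ (ρ n)) := by
  funext n; cases n <;> rfl

theorem subst_var (t : Tm) : subst var t = t := by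
  induction t <;> simp_all [subst, ups_var]

theorem subst_rename (t : Tm) (ρ : ℕ → ℕ) (σ : ℕ → Tm) :
    subst σ (rename ρ t) = subst (fun n => σ (ρ n)) t := by
  induction t generalizing ρ σ <;> simp_all [subst, rename, ups_comp_upr]

theorem rename_rename (t : Tm) (ρ τ : ℕ → ℕ) :
    rename τ (rename ρ t) = rename (fun n => τ (ρ n)) t := by
  have h : ∀ ρ τ : ℕ → ℕ, (fun n => upr τ (upr ρ n)) = upr (fun n => τ (ρ n)) := fun ρ τ => by
    funext n; cases n <;> rfl
  induction t generalizing ρ τ <;> simp_all [rename]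

theorem rename_upr_shift (t : Tm) :
    rename (upr fun n => n + 1) t.shift = t.shift.shift := by
  unfold shift
  rw [rename_rename, rename_rename]
  rfl

theorem shift_inst (t u : Tm) : t.shift.inst u = t := by
  unfold shift inst
  rw [subst_rename]
  exact subst_var t

theorem rename_upr_inst_zero (t : Tm) : (rename (upr fun n => n + 1) t).inst (var 0) = t := by
  unfold inst
  rw [subst_rename]
  have h : (fun n => scons (var 0) var (upr (fun n => n + 1) n)) = var := by
    funext n; cases n <;> rfl
  rw [h, subst_var]

end Tm

/-! ### Restriction of contexts -/

theorem Ctx.restrVars_getElem? {e : Entry} (he : ∀ A, e ≠ .tm A) :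
    ∀ {Γ : List Entry} {x n : ℕ}, Γ[x]? = some .name → Γ[n]? = some e → n ≠ x →
      (Ctx.restrVars Γ x)[n]? = some e
  | [], _, _, h, _, _ => by simp at h
  | a :: Γ, 0, 0, _, _, h => absurd rfl h
  | a :: Γ, 0, n + 1, _, h, _ => by simpa [Ctx.restrVars] using h
  | a :: Γ, x + 1, 0, _, h, _ => by
      cases a <;> simp_all [Ctx.restrVars]
      exact absurd h.symm (he _)
  | a :: Γ, x + 1, n + 1, h, h', hn => by
      have := Ctx.restrVars_getElem? he (Γ := Γ) (x := x) (n := n) (by simpa using h)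
        (by simpa using h') (by omega)
      cases a <;> simpa [Ctx.restrVars] using this

theorem Ctx.isName_zero {Γ : Ctx} : Γ.name.IsName 0 := rfl

theorem Ctx.IsName.succ {Γ : Ctx} {x : ℕ} {e : Entry} (h : Γ.IsName x) :
    (Γ.snoc e).IsName (x + 1) := h

theorem IsDim.restr {Γ : Ctx} {x : ℕ} (hx : Γ.IsName x) {r : Tm} (h : IsDim Γ r) :
    IsDim (Γ.restr x) r := by
  cases h with
  | i0 => exact .i0
  | i1 => exact .i1
  | @var n h =>
    refine .var (Ctx.restrVars_getElem? (by simp) hx h ?_)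
    rintro rfl
    rw [Ctx.IsName, h] at hx
    simp at hx

/-- `x` has to be a bridge variable: a restriction at a path dimension could remove a dimension that
occurs in a constraint. -/
theorem Wf.restr : ∀ {Γ : Ctx}, Wf Γ → ∀ {x : ℕ}, Γ.IsName x → Wf (Γ.restr x)
  | _, .empty, _, hx => by simp [Ctx.IsName, Ctx.empty] at hx
  | _, .tm h _, 0, _ => h.removed
  | _, .tm h _, x + 1, hx => (Wf.restr h (x := x) hx).removed
  | _, .name h, 0, _ => h.removed
  | _, .name h, x + 1, hx => (Wf.restr h (x := x) hx).name
  | _, .dim h, 0, _ => h.removed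
  | _, .dim h, x + 1, hx => (Wf.restr h (x := x) hx).dim
  | _, .removed h, 0, _ => h.removed
  | _, .removed h, x + 1, hx => (Wf.restr h (x := x) hx).removed
  | _, .cof (Γ := Γ) h hr hs, x, hx =>
      have hx' : Γ.IsName x := hx
      (Wf.restr h hx').cof (hr.restr hx') (hs.restr hx')

/-! ### Rules with computed substitutions

The substitution instances in the conclusions of the rules are replaced by the terms to which they
evaluate. -/

theorem HasTy.var' {n : ℕ} {A T : Tm} (hΓ : Wf Γ) (h : Γ.vars[n]? = some (.tm A))
    (hT : rename (fun m => m + (n + 1)) A = T := by rfl) : HasTy Γ (.var n) T :=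
  hT ▸ .var hΓ h

theorem HasTy.app' {A B f a T : Tm} (hf : HasTy Γ f (.pi A B)) (ha : HasTy Γ a A)
    (hT : B.inst a = T := by rfl) : HasTy Γ (.app f a) T :=
  hT ▸ .app hf ha

theorem HasTy.bapp' {A a T : Tm} {x : ℕ} (hΓ : Wf Γ) (hx : Γ.IsName x)
    (ha : HasTy (Γ.restr x) a (.bridge A)) (hT : A.inst (.var x) = T := by rfl) :
    HasTy Γ (.bapp a (.var x)) T :=
  hT ▸ .bapp hΓ hx ha

theorem EqTm.app' {A B f f' a a' T : Tm} (hf : EqTm Γ f f' (.pi A B)) (ha : EqTm Γ a a' A)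
    (hT : B.inst a = T := by rfl) : EqTm Γ (.app f a) (.app f' a') T :=
  hT ▸ .app hf ha

theorem EqTm.pi_beta' {A B b a T t : Tm} (hb : HasTy (Γ.tm A) b B) (ha : HasTy Γ a A)
    (ht : b.inst a = t := by rfl) (hT : B.inst a = T := by rfl) :
    EqTm Γ (.app (.lam b) a) t T :=
  ht ▸ hT ▸ .pi_beta hb ha

theorem EqTm.bapp' {A a a' T : Tm} {x : ℕ} (hΓ : Wf Γ) (hx : Γ.IsName x)
    (ha : EqTm (Γ.restr x) a a' (.bridge A)) (hT : A.inst (.var x) = T := by rfl) :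
    EqTm Γ (.bapp a (.var x)) (.bapp a' (.var x)) T :=
  hT ▸ .bapp hΓ hx ha

theorem EqTm.bridge_beta' {A a t T : Tm} {x : ℕ} (hΓ : Wf Γ) (hx : Γ.IsName x)
    (ha : HasTy (Γ.restr x).name a A) (ht : a.inst (.var x) = t := by rfl)
    (hT : A.inst (.var x) = T := by rfl) :
    EqTm Γ (.bapp (.blam a) (.var x)) t T :=
  ht ▸ hT ▸ .bridge_beta hΓ hx ha

/-! ### The basic types -/

theorem onePlusNm_type (hΓ : Wf Γ) {l : ℕ} : HasTy Γ onePlusNm (.univ l) :=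
  .sum (.unit hΓ) (.Nm hΓ)

theorem bridgeNm_type (hΓ : Wf Γ) {l : ℕ} : HasTy Γ bridgeNm (.univ l) :=
  .bridge (.Nm hΓ.name)

theorem GelNm_type (hΓ : Wf Γ) {x l : ℕ} (hx : Γ.IsName x) :
    HasTy Γ (.Gel .Nm (.var x)) (.univ l) :=
  .Gel hΓ hx (.Nm (hΓ.restr hx))

theorem GelOnePlusNm_type (hΓ : Wf Γ) {x l : ℕ} (hx : Γ.IsName x) :
    HasTy Γ (.Gel onePlusNm (.var x)) (.univ l) :=
  .Gel hΓ hx (onePlusNm_type (hΓ.restr hx))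

theorem sumGel_type (hΓ : Wf Γ) {x l : ℕ} (hx : Γ.IsName x) :
    HasTy Γ (.sum .unit (.Gel .Nm (.var x))) (.univ l) :=
  .sum (.unit hΓ) (GelNm_type hΓ hx)

/-- The bridge type `(x : 𝔸) ⊸ Gel Nm x`. -/
def bridgeGel : Tm := .bridge (.Gel .Nm (.var 0))

theorem bridgeGel_type (hΓ : Wf Γ) {l : ℕ} : HasTy Γ bridgeGel (.univ l) :=
  .bridge (GelNm_type hΓ.name rfl)

theorem Wf.tmNm (hΓ : Wf Γ) : Wf (Γ.tm .Nm) := hΓ.tm (.Nm (l := 0) hΓ)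
theorem Wf.tmUnit (hΓ : Wf Γ) : Wf (Γ.tm .unit) := hΓ.tm (.unit (l := 0) hΓ)
theorem Wf.tmOnePlusNm (hΓ : Wf Γ) : Wf (Γ.tm onePlusNm) := hΓ.tm (onePlusNm_type (l := 0) hΓ)
theorem Wf.tmBridgeNm (hΓ : Wf Γ) : Wf (Γ.tm bridgeNm) := hΓ.tm (bridgeNm_type (l := 0) hΓ)
theorem Wf.tmBridgeGel (hΓ : Wf Γ) : Wf (Γ.tm bridgeGel) := hΓ.tm (bridgeGel_type (l := 0) hΓ)
theorem Wf.tmGelNm (hΓ : Wf Γ) {x : ℕ} (hx : Γ.IsName x) : Wf (Γ.tm (.Gel .Nm (.var x))) :=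
  hΓ.tm (GelNm_type (l := 0) hΓ hx)
theorem Wf.tmSumGel (hΓ : Wf Γ) {x : ℕ} (hx : Γ.IsName x) :
    Wf (Γ.tm (.sum .unit (.Gel .Nm (.var x)))) :=
  hΓ.tm (sumGel_type (l := 0) hΓ hx)

/-! ### Typing and computation of `loosen` -/

theorem loosen_branch_inl (hΓ : Wf Γ) : HasTy (Γ.tm .unit) (.blam (.cart (.var 0))) bridgeNm :=
  .blam (.cart hΓ.tmUnit.name rfl)

theorem loosen_branch_inr (hΓ : Wf Γ) : HasTy (Γ.tm .Nm) (.blam (.var 1)) bridgeNm :=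
  .blam (.var' hΓ.tmNm.name rfl)

theorem loosen_body_type (hΓ : Wf Γ) :
    HasTy (Γ.tm onePlusNm) (.case (.var 0) (.blam (.cart (.var 0))) (.blam (.var 1))) bridgeNm :=
  .case (l := 0) (C := bridgeNm) (A := .unit) (B := .Nm)
    (.var' hΓ.tmOnePlusNm rfl) (bridgeNm_type (hΓ.tmOnePlusNm.tmOnePlusNm))
    (loosen_branch_inl hΓ.tmOnePlusNm) (loosen_branch_inr hΓ.tmOnePlusNm)

theorem loosen_type (hΓ : Wf Γ) : HasTy Γ loosen (.arrow onePlusNm bridgeNm) :=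
  .lam (l := 0) (onePlusNm_type hΓ) (loosen_body_type hΓ)

theorem app_loosen_type (hΓ : Wf Γ) {s : Tm} (hs : HasTy Γ s onePlusNm) :
    HasTy Γ (.app loosen s) bridgeNm :=
  .app' (loosen_type hΓ) hs

theorem app_loosen_congr (hΓ : Wf Γ) {s s' : Tm} (hs : EqTm Γ s s' onePlusNm) :
    EqTm Γ (.app loosen s) (.app loosen s') bridgeNm :=
  .app' (.refl (loosen_type hΓ)) hs

theorem loosen_inl (hΓ : Wf Γ) {u : Tm} (hu : HasTy Γ u .unit) :
    EqTm Γ (.app loosen (.inl u)) (.blam (.cart (.var 0))) bridgeNm :=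
  .trans (.pi_beta (loosen_body_type hΓ) (.inl hu (.Nm (l := 0) hΓ)))
    (.case_inl (l := 0) (C := bridgeNm) (A := .unit) (B := .Nm) hu (bridgeNm_type hΓ.tmOnePlusNm)
      (loosen_branch_inl hΓ) (loosen_branch_inr hΓ))

theorem loosen_inr (hΓ : Wf Γ) {n : Tm} (hn : HasTy Γ n .Nm) :
    EqTm Γ (.app loosen (.inr n)) (.blam n.shift) bridgeNm :=
  .trans (.pi_beta (loosen_body_type hΓ) (.inr (.unit (l := 0) hΓ) hn))
    (.case_inr (l := 0) (C := bridgeNm) (A := .unit) (B := .Nm) hn (bridgeNm_type hΓ.tmOnePlusNm)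
      (loosen_branch_inl hΓ) (loosen_branch_inr hΓ))

/-! ### The map `t1` at a bridge variable -/

/-- `ind x m (inl ⋆) (λ g. inr g)`, the body of `t1` at a bridge variable `x` and a name `m`. -/
def t1At (x : ℕ) (m : Tm) : Tm := .indNm (.var x) m (.inl .star) (.inr (.var 0))

/-- The motive and the two branches of the name induction in `t1At`. -/
theorem t1At_aux (hΓ : Wf Γ) (hx : Γ.IsName x) :
    HasTy (Γ.tm .Nm) (.sum .unit (.Gel .Nm (.var (x + 1)))) (.univ 0) ∧
    HasTy Γ (.inl .star) (.sum .unit (.Gel .Nm (.var x))) ∧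
    HasTy (Γ.tm (.Gel .Nm (.var x))) (.inr (.var 0)) (.sum .unit (.Gel .Nm (.var (x + 1)))) :=
  ⟨sumGel_type hΓ.tmNm hx, .inl (.star hΓ) (GelNm_type (l := 0) hΓ hx),
    .inr (.unit (l := 0) (hΓ.tmGelNm hx)) (.var' (hΓ.tmGelNm hx) rfl)⟩

theorem t1At_type (hΓ : Wf Γ) (hx : Γ.IsName x) {m : Tm} (hm : HasTy Γ m .Nm) :
    HasTy Γ (t1At x m) (.sum .unit (.Gel .Nm (.var x))) :=
  have ⟨h, h₀, h₁⟩ := t1At_aux hΓ hx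
  .indNm (B := .sum .unit (.Gel .Nm (.var (x + 1)))) hx hm h h₀ h₁

theorem t1At_congr (hΓ : Wf Γ) (hx : Γ.IsName x) {m m' : Tm} (hm : EqTm Γ m m' .Nm) :
    EqTm Γ (t1At x m) (t1At x m') (.sum .unit (.Gel .Nm (.var x))) :=
  have ⟨h, h₀, h₁⟩ := t1At_aux hΓ hx
  .indNm (B := .sum .unit (.Gel .Nm (.var (x + 1)))) hx hm h (.refl h₀) (.refl h₁)

theorem t1At_cart (hΓ : Wf Γ) (hx : Γ.IsName x) :
    EqTm Γ (t1At x (.cart (.var x))) (.inl .star) (.sum .unit (.Gel .Nm (.var x))) :=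
  have ⟨h, h₀, h₁⟩ := t1At_aux hΓ hx
  .Nm_beta₀ (B := .sum .unit (.Gel .Nm (.var (x + 1)))) hx h h₀ h₁

theorem t1At_fresh (hΓ : Wf Γ) (hx : Γ.IsName x) {n : Tm} (hn : HasTy (Γ.restr x) n .Nm) :
    EqTm Γ (t1At x n) (.inr (.gel n (.var x))) (.sum .unit (.Gel .Nm (.var x))) :=
  have ⟨h, h₀, h₁⟩ := t1At_aux hΓ hx
  .Nm_beta₁ (B := .sum .unit (.Gel .Nm (.var (x + 1)))) hx h h₀ h₁ hn

/-! ### The map `t2` at a bridge variable -/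

/-- The right branch of `t2pre`, `ext (λ g' y. gel (inr (ung g')) y) x g`. -/
def t2Ext (x : ℕ) (g : Tm) : Tm :=
  .extent (.gel (.inr (.ung (.bapp (.var 2) (.var 0)))) (.var 0)) (.var x) g

/-- The body of `t2pre` at a bridge variable `x` and an argument `s`. -/
def t2At (x : ℕ) (s : Tm) : Tm :=
  .case s (.gel (.inl .star) (.var (x + 1))) (t2Ext (x + 1) (.var 0))

theorem ung_bapp_type (hΓ : Wf Γ) {k : ℕ} (hk : (Γ.vars)[k]? = some (.tm bridgeGel)) :
    HasTy Γ (.ung (.bapp (.var (k + 1)) (.var 0))) .Nm :=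
  .ung (.bapp' (A := .Gel .Nm (.var 0)) hΓ.name rfl
    (.var' (A := bridgeGel) (Wf.restr hΓ.name rfl) hk))

theorem t2Ext_body_type (hΓ : Wf Γ) :
    HasTy (Γ.tm bridgeGel).name (.gel (.inr (.ung (.bapp (.var 2) (.var 0)))) (.var 0))
      (.Gel onePlusNm (.var 0)) :=
  have h := hΓ.tmBridgeGel.removed
  .gel hΓ.tmBridgeGel.name rfl (.inr (.unit (l := 0) h) (ung_bapp_type h rfl))

theorem t2Ext_type (hΓ : Wf Γ) (hx : Γ.IsName x) {g : Tm} (hg : HasTy Γ g (.Gel .Nm (.var x))) :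
    HasTy Γ (t2Ext x g) (.Gel onePlusNm (.var x)) :=
  have h := (hΓ.restr hx).name
  .extent (A := .Gel .Nm (.var 0)) (B := .Gel onePlusNm (.var 1)) (l := 0) hx
    (GelNm_type h isName_zero) (GelOnePlusNm_type (h.tmGelNm isName_zero) isName_zero.succ)
    (t2Ext_body_type (hΓ.restr hx)) hg

/-- `n : A` holds in `Γ` and in the extensions of `Γ` by a bridge variable and by one and two
removed entries. These weakenings are what the computation rules for `ung` and `ext` ask of a
fresh `n`: its occurrence under a bridge abstraction that is applied to `x` is typed in
`(Γ, x) ∖ x`. -/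
structure WkTy (Γ : Ctx) (n A : Tm) : Prop where
  ty : HasTy Γ n A
  ty₁ : HasTy (Γ.snoc .removed) n.shift A.shift
  ty_name : HasTy Γ.name n.shift A.shift
  ty₂ : HasTy ((Γ.snoc .removed).snoc .removed) n.shift.shift A.shift.shift

/-- `ung (λ y. (λ x. gel n x) y) = n` -/
theorem ung_bapp_blam_gel (hΓ : Wf Γ) {n : Tm} (hn : WkTy Γ n .Nm) :
    EqTm Γ (.ung (.bapp (.blam (.gel n.shift.shift (.var 0))) (.var 0))) n .Nm :=
  .trans
    (.ung (.bridge_beta' (A := .Gel .Nm (.var 0)) hΓ.name rfl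
      (.gel hΓ.removed.name rfl hn.ty₂)
      (ht := congrArg (Tm.gel · (.var 0)) (shift_inst n.shift (.var 0)))))
    (.Gel_beta hn.ty)

theorem gel_type (hΓ : Wf Γ) (hx : Γ.IsName x) {n A : Tm} (hn : HasTy (Γ.restr x) n A) :
    HasTy Γ (.gel n (.var x)) (.Gel A (.var x)) := .gel hΓ hx hn

/-- `ext (λ g' y. gel (inr (ung g')) y) x (gel n x) = gel (inr n) x` for fresh `n`. -/
theorem t2Ext_fresh (hΓ : Wf Γ) (hx : Γ.IsName x) {n : Tm} (hn : WkTy (Γ.restr x) n .Nm) :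
    EqTm Γ (t2Ext x (.gel n (.var x))) (.gel (.inr n) (.var x)) (.Gel onePlusNm (.var x)) := by
  have h := hΓ.restr hx
  have e := EqTm.extent_beta (A := .Gel .Nm (.var 0)) (B := .Gel onePlusNm (.var 1)) (l := 0)
    hΓ hx (GelNm_type h.name isName_zero)
    (GelOnePlusNm_type (h.name.tmGelNm isName_zero) isName_zero.succ)
    (t2Ext_body_type h) (a := .gel n.shift (.var 0)) (gel_type h.name isName_zero hn.ty₁)
  -- `gel n x` is the value at `x` of the bridge `λ y. gel n y`, as the rule for `ext` demands.
  have hi : (Tm.gel n.shift (.var 0)).inst (.var x) = .gel n (.var x) :=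
    congrArg (Tm.gel · (.var x)) (shift_inst n (.var x))
  have hs : (Tm.gel n.shift (.var 0)).rename (upr fun n => n + 1) = .gel n.shift.shift (.var 0) :=
    congrArg (Tm.gel · (.var 0)) (rename_upr_shift n)
  rw [hi] at e
  have e : EqTm Γ _ (.gel (.inr (.ung (.bapp (.blam (.rename (upr fun n => n + 1)
    (.gel n.shift (.var 0)))) (.var 0)))) (.var x)) _ := e
  rw [hs] at e
  exact .trans e (.gel hΓ hx (.inr (.unit (l := 0) h) (ung_bapp_blam_gel h hn)))

/-- The motive and the two branches of the case analysis in `t2At`. -/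
theorem t2At_aux (hΓ : Wf Γ) (hx : Γ.IsName x) :
    HasTy (Γ.tm (.sum .unit (.Gel .Nm (.var x)))) (.Gel onePlusNm (.var (x + 1))) (.univ 0) ∧
    HasTy (Γ.tm .unit) (.gel (.inl .star) (.var (x + 1))) (.Gel onePlusNm (.var (x + 1))) ∧
    HasTy (Γ.tm (.Gel .Nm (.var x))) (t2Ext (x + 1) (.var 0)) (.Gel onePlusNm (.var (x + 1))) :=
  have h := (hΓ.restr hx).removed
  ⟨GelOnePlusNm_type (hΓ.tmSumGel hx) hx.succ,
    .gel hΓ.tmUnit hx.succ (.inl (.star h) (.Nm (l := 0) h)),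
    t2Ext_type (hΓ.tmGelNm hx) hx.succ (.var' (hΓ.tmGelNm hx) rfl)⟩

theorem t2At_type (hΓ : Wf Γ) (hx : Γ.IsName x) {s : Tm}
    (hs : HasTy Γ s (.sum .unit (.Gel .Nm (.var x)))) :
    HasTy Γ (t2At x s) (.Gel onePlusNm (.var x)) :=
  have ⟨h, h₀, h₁⟩ := t2At_aux hΓ hx
  .case (C := .Gel onePlusNm (.var (x + 1))) hs h h₀ h₁

theorem t2At_congr (hΓ : Wf Γ) (hx : Γ.IsName x) {s s' : Tm}
    (hs : EqTm Γ s s' (.sum .unit (.Gel .Nm (.var x)))) :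
    EqTm Γ (t2At x s) (t2At x s') (.Gel onePlusNm (.var x)) :=
  have ⟨h, h₀, h₁⟩ := t2At_aux hΓ hx
  .case (C := .Gel onePlusNm (.var (x + 1))) hs h (.refl h₀) (.refl h₁)

theorem t2At_inl (hΓ : Wf Γ) (hx : Γ.IsName x) :
    EqTm Γ (t2At x (.inl .star)) (.gel (.inl .star) (.var x)) (.Gel onePlusNm (.var x)) :=
  have ⟨h, h₀, h₁⟩ := t2At_aux hΓ hx
  .case_inl (A := .unit) (B := .Gel .Nm (.var x)) (C := .Gel onePlusNm (.var (x + 1)))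
    (.star hΓ) h h₀ h₁

theorem t2At_inr (hΓ : Wf Γ) (hx : Γ.IsName x) {g : Tm} (hg : HasTy Γ g (.Gel .Nm (.var x))) :
    EqTm Γ (t2At x (.inr g)) (t2Ext x g) (.Gel onePlusNm (.var x)) :=
  have ⟨h, h₀, h₁⟩ := t2At_aux hΓ hx
  .case_inr (A := .unit) (B := .Gel .Nm (.var x)) (C := .Gel onePlusNm (.var (x + 1)))
    hg h h₀ h₁

/-! ### The map `tighten` at a bridge variable -/

/-- `t2pre x (ind x m (inl ⋆) (λ g. inr g)) : Gel (1 + Nm) x`, so that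
`tighten n' = ung (λ x. tightenAt x (n' x))`. -/
def tightenAt (x : ℕ) (m : Tm) : Tm := t2At x (t1At x m)

theorem tightenAt_type (hΓ : Wf Γ) (hx : Γ.IsName x) {m : Tm} (hm : HasTy Γ m .Nm) :
    HasTy Γ (tightenAt x m) (.Gel onePlusNm (.var x)) :=
  t2At_type hΓ hx (t1At_type hΓ hx hm)

theorem tightenAt_congr (hΓ : Wf Γ) (hx : Γ.IsName x) {m m' : Tm} (hm : EqTm Γ m m' .Nm) :
    EqTm Γ (tightenAt x m) (tightenAt x m') (.Gel onePlusNm (.var x)) :=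
  t2At_congr hΓ hx (t1At_congr hΓ hx hm)

theorem tightenAt_cart (hΓ : Wf Γ) (hx : Γ.IsName x) :
    EqTm Γ (tightenAt x (.cart (.var x))) (.gel (.inl .star) (.var x))
      (.Gel onePlusNm (.var x)) :=
  .trans (t2At_congr hΓ hx (t1At_cart hΓ hx)) (t2At_inl hΓ hx)

theorem tightenAt_fresh (hΓ : Wf Γ) (hx : Γ.IsName x) {n : Tm} (hn : WkTy (Γ.restr x) n .Nm) :
    EqTm Γ (tightenAt x n) (.gel (.inr n) (.var x)) (.Gel onePlusNm (.var x)) :=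
  .trans (t2At_congr hΓ hx (t1At_fresh hΓ hx hn.ty))
    (.trans (t2At_inr hΓ hx (.gel hΓ hx hn.ty)) (t2Ext_fresh hΓ hx hn))

/-! ### Typing and computation of `tighten` -/

/-- The simplified form `λ n'. ung (λ x. tightenAt x (n' x))` of `tighten`. -/
def tightenNf : Tm := .lam (.ung (tightenAt 0 (.bapp (.var 1) (.var 0))))

/-- `(x : 𝔸) ⊸ 1 + Gel Nm x`, the codomain of `t1`. -/
def bridgeSum : Tm := .bridge (.sum .unit (.Gel .Nm (.var 0)))

/-- `(x : 𝔸) ⊸ Gel (1 + Nm) x`, the codomain of `t2`. -/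
def bridgeGelSum : Tm := .bridge (.Gel onePlusNm (.var 0))

theorem bridgeSum_type (hΓ : Wf Γ) : HasTy Γ bridgeSum (.univ 0) :=
  .bridge (sumGel_type hΓ.name rfl)

theorem Wf.tmBridgeSum (hΓ : Wf Γ) : Wf (Γ.tm bridgeSum) := hΓ.tm (bridgeSum_type hΓ)

theorem bapp_var_type (hΓ : Wf Γ) (hx : Γ.IsName x) {k : ℕ} {A T : Tm}
    (hk : (Γ.restr x).vars[k]? = some (.tm A))
    (hA : rename (fun m => m + (k + 1)) A = bridge T) {T' : Tm} (hT : T.inst (.var x) = T') :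
    HasTy Γ (.bapp (.var k) (.var x)) T' :=
  .bapp' hΓ hx (.var' (hΓ.restr hx) hk hA) hT

theorem bapp_var_Nm (hΓ : Wf Γ) (hx : Γ.IsName x) {k : ℕ}
    (hk : (Γ.restr x).vars[k]? = some (.tm bridgeNm)) :
    HasTy Γ (.bapp (.var k) (.var x)) .Nm :=
  bapp_var_type hΓ hx hk rfl rfl

theorem t1_body_type (hΓ : Wf Γ) :
    HasTy (Γ.tm bridgeNm) (.blam (t1At 0 (.bapp (.var 1) (.var 0)))) bridgeSum :=
  have h := hΓ.tmBridgeNm.name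
  .blam (t1At_type h isName_zero (bapp_var_Nm h isName_zero rfl))

theorem t1_type (hΓ : Wf Γ) : HasTy Γ t1 (.arrow bridgeNm bridgeSum) :=
  .lam (bridgeNm_type (l := 0) hΓ) (t1_body_type hΓ)

theorem t2pre_body_type (hΓ : Wf Γ) :
    HasTy Γ.name (.lam (t2At 1 (.var 0)))
      (.pi (.sum .unit (.Gel .Nm (.var 0))) (.Gel onePlusNm (.var 1))) :=
  have h := hΓ.name.tmSumGel isName_zero
  .lam (sumGel_type (l := 0) hΓ.name rfl) (t2At_type h isName_zero.succ (.var' h rfl))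

theorem t2pre_type (hΓ : Wf Γ) :
    HasTy Γ t2pre
      (.bridge (.pi (.sum .unit (.Gel .Nm (.var 0))) (.Gel onePlusNm (.var 1)))) :=
  .blam (t2pre_body_type hΓ)

theorem app_bapp_t2pre (hΓ : Wf Γ) (hx : Γ.IsName x) {s : Tm}
    (hs : HasTy Γ s (.sum .unit (.Gel .Nm (.var x)))) :
    EqTm Γ (.app (.bapp t2pre (.var x)) s) (t2At x s) (.Gel onePlusNm (.var x)) :=
  have h := hΓ.tmSumGel hx
  .trans
    (.app' (A := .sum .unit (.Gel .Nm (.var x))) (B := .Gel onePlusNm (.var (x + 1)))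
      (.bridge_beta' hΓ hx (t2pre_body_type (hΓ.restr hx))) (.refl hs))
    (.pi_beta (t2At_type h hx.succ (.var' (A := .sum .unit (.Gel .Nm (.var x))) h rfl)) hs)

theorem t2_body_type (hΓ : Wf Γ) :
    HasTy (Γ.tm bridgeSum)
      (.blam (.app (.bapp t2pre (.var 0)) (.bapp (.var 1) (.var 0)))) bridgeGelSum :=
  have h := hΓ.tmBridgeSum.name
  .blam (.app' (A := .sum .unit (.Gel .Nm (.var 0))) (B := .Gel onePlusNm (.var 1))
    (.bapp' h rfl (t2pre_type hΓ.tmBridgeSum.removed)) (bapp_var_type h isName_zero rfl rfl rfl))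

theorem t2_type (hΓ : Wf Γ) : HasTy Γ t2 (.arrow bridgeSum bridgeGelSum) :=
  .lam (bridgeSum_type hΓ) (t2_body_type hΓ)

theorem tighten_type (hΓ : Wf Γ) : HasTy Γ tighten (.arrow bridgeNm onePlusNm) :=
  have h := hΓ.tmBridgeNm
  .lam (bridgeNm_type (l := 0) hΓ) (.ung (.bapp' (A := .Gel onePlusNm (.var 0)) h.name isName_zero
    (.app' (A := bridgeSum) (B := bridgeGelSum) (t2_type h.removed)
      (.app' (A := bridgeNm) (B := bridgeSum) (t1_type h.removed) (.var' h.removed rfl)))))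

theorem tightenNf_body_type (hΓ : Wf Γ) :
    HasTy (Γ.tm bridgeNm) (.ung (tightenAt 0 (.bapp (.var 1) (.var 0)))) onePlusNm :=
  have h := hΓ.tmBridgeNm.name
  .ung (tightenAt_type h isName_zero (bapp_var_Nm h isName_zero rfl))

theorem bapp_blam_t1At_type (hΓ : Wf Γ) (hx : Γ.IsName x) {k : ℕ}
    (hk : (Γ.restr x).vars[k]? = some (.tm bridgeNm)) :
    HasTy Γ (.bapp (.blam (t1At 0 (.bapp (.var (k + 1)) (.var 0)))) (.var x))
      (.sum .unit (.Gel .Nm (.var x))) :=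
  have h := (hΓ.restr hx).name
  .bapp' hΓ hx (.blam (t1At_type h isName_zero (bapp_var_Nm h isName_zero hk)))

/-- The β-reductions take place under the binder of `tighten`, where its argument is a variable. -/
theorem tighten_eq (hΓ : Wf Γ) : EqTm Γ tighten tightenNf (.arrow bridgeNm onePlusNm) := by
  have h := hΓ.tmBridgeNm
  have hr := h.removed.name
  refine .lam (bridgeNm_type (l := 0) hΓ) (.ung ?_)
  -- `t1 n'`, then `t2 (t1 n')` are replaced by bridge abstractions,
  refine .trans (.bapp' (A := .Gel onePlusNm (.var 0)) h.name isName_zero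
    (.trans (.app' (A := bridgeSum) (B := bridgeGelSum) (.refl (t2_type h.removed))
      (.pi_beta' (A := bridgeNm) (B := bridgeSum) (t1_body_type h.removed) (.var' h.removed rfl)
        (t := .blam (t1At 0 (.bapp (.var 2) (.var 0))))))
      (.pi_beta (t2_body_type h.removed)
        (.blam (t1At_type hr isName_zero (bapp_var_Nm hr isName_zero rfl)))))) ?_
  -- the outer one is applied to `x`,
  refine .trans (.bridge_beta' (A := .Gel onePlusNm (.var 0)) h.name isName_zero
    (a := .app (.bapp t2pre (.var 0)) (.bapp (.blam (t1At 0 (.bapp (.var 3) (.var 0)))) (.var 0)))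
    (.app' (A := .sum .unit (.Gel .Nm (.var 0))) (B := .Gel onePlusNm (.var 1))
      (.bapp' hr isName_zero (t2pre_type h.removed.removed))
      (bapp_blam_t1At_type hr isName_zero rfl))
    (t := .app (.bapp t2pre (.var 0)) (.bapp (.blam (t1At 0 (.bapp (.var 2) (.var 0))))
      (.var 0)))) ?_
  -- `t2pre x` is unfolded,
  refine .trans (app_bapp_t2pre h.name isName_zero
    (bapp_blam_t1At_type h.name isName_zero rfl)) ?_
  -- and the inner one is applied to `x`.
  exact t2At_congr h.name isName_zero
    (.bridge_beta' h.name isName_zero (t1At_type hr isName_zero (bapp_var_Nm hr isName_zero rfl)))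

theorem app_tighten_type (hΓ : Wf Γ) {n : Tm} (hn : HasTy Γ n bridgeNm) :
    HasTy Γ (.app tighten n) onePlusNm :=
  .app' (tighten_type hΓ) hn

theorem app_tighten_congr (hΓ : Wf Γ) {n n' : Tm} (hn : EqTm Γ n n' bridgeNm) :
    EqTm Γ (.app tighten n) (.app tighten n') onePlusNm :=
  .app' (.refl (tighten_type hΓ)) hn

theorem app_tighten (hΓ : Wf Γ) {n : Tm} (hn : HasTy Γ n bridgeNm) :
    EqTm Γ (.app tighten n) (.ung (tightenAt 0 (.bapp n.shift (.var 0)))) onePlusNm :=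
  .trans (.app' (tighten_eq hΓ) (.refl hn)) (.pi_beta (tightenNf_body_type hΓ) hn)

theorem tighten_blam_cart (hΓ : Wf Γ) :
    EqTm Γ (.app tighten (.blam (.cart (.var 0)))) (.inl .star) onePlusNm := by
  refine .trans (app_tighten hΓ (.blam (.cart hΓ.name rfl))) ?_
  refine .trans (.ung (.trans (tightenAt_congr hΓ.name isName_zero
    (.bridge_beta' hΓ.name isName_zero (.cart hΓ.removed.name rfl)))
    (tightenAt_cart hΓ.name isName_zero))) ?_
  exact .Gel_beta (a := .inl .star) (.inl (.star hΓ) (.Nm (l := 0) hΓ))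

theorem wkTy_var (hΓ : Wf Γ) {k : ℕ} (hk : Γ.vars[k]? = some (.tm .Nm)) :
    WkTy Γ (.var k) .Nm :=
  ⟨.var' hΓ hk, .var' hΓ.removed hk, .var' hΓ.name hk, .var' hΓ.removed.removed hk⟩

theorem bapp_blam_var (hΓ : Wf Γ) (hx : Γ.IsName x) {k : ℕ}
    (hk : (Γ.restr x).vars[k]? = some (.tm .Nm)) :
    EqTm Γ (.bapp (.blam (.var (k + 1))) (.var x)) (.var k) .Nm :=
  have h := (hΓ.restr hx).name
  .bridge_beta' hΓ hx (.var' h hk)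

theorem tighten_blam_var (hΓ : Wf Γ) {k : ℕ} (hk : Γ.vars[k]? = some (.tm .Nm)) :
    EqTm Γ (.app tighten (.blam (.var (k + 1)))) (.inr (.var k)) onePlusNm := by
  have hΔ := hΓ.removed
  refine .trans (app_tighten hΓ (.blam (.var' hΓ.name hk))) ?_
  refine .trans (.ung (.trans (tightenAt_congr hΓ.name isName_zero
    (bapp_blam_var hΓ.name isName_zero hk))
    (tightenAt_fresh hΓ.name isName_zero (wkTy_var hΔ hk)))) ?_
  exact .Gel_beta (a := .inr (.var k)) (.inr (.unit (l := 0) hΓ) (.var' hΓ hk))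

theorem tighten_loosen_inl (hΓ : Wf Γ) {u : Tm} (hu : HasTy Γ u .unit) :
    EqTm Γ (.app tighten (.app loosen (.inl u))) (.inl u) onePlusNm :=
  .trans (app_tighten_congr hΓ (loosen_inl hΓ hu)) (.trans (tighten_blam_cart hΓ)
    (.inl (.symm (.unit_eta hu)) (.Nm (l := 0) hΓ)))

/-- The restriction to a variable under `inr` spares its weakenings; case analysis needs no more. -/
theorem tighten_loosen_inr (hΓ : Wf Γ) {k : ℕ} (hk : Γ.vars[k]? = some (.tm .Nm)) :
    EqTm Γ (.app tighten (.app loosen (.inr (.var k)))) (.inr (.var k)) onePlusNm :=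
  .trans (app_tighten_congr hΓ (loosen_inr hΓ (.var' hΓ hk))) (tighten_blam_var hΓ hk)

theorem Wf.tmGelOnePlusNm (hΓ : Wf Γ) (hx : Γ.IsName x) : Wf (Γ.tm (.Gel onePlusNm (.var x))) :=
  hΓ.tm (GelOnePlusNm_type (l := 0) hΓ hx)

theorem Wf.tmBridgeGelSum (hΓ : Wf Γ) : Wf (Γ.tm bridgeGelSum) :=
  hΓ.tm (.bridge (GelOnePlusNm_type (l := 0) hΓ.name isName_zero))

theorem wkTy_ung_bapp (hΓ : Wf Γ) {k : ℕ} (hk : Γ.vars[k]? = some (.tm bridgeGel)) :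
    WkTy Γ (.ung (.bapp (.var (k + 1)) (.var 0))) .Nm :=
  ⟨ung_bapp_type hΓ hk, ung_bapp_type hΓ.removed hk, ung_bapp_type hΓ.name hk,
    ung_bapp_type hΓ.removed.removed hk⟩

/-- `ung (λ x. (λ y. a) x) = ung (λ y. a)`. The inner abstraction is typed without `x`, so the
weakening of `a` in the hypothesis is by a removed entry. -/
theorem ung_bapp_blam (hΓ : Wf Γ) {a A : Tm} (hA : A.shift = A)
    (ha : HasTy (Γ.snoc .removed).name (a.rename (upr fun n => n + 1)) (.Gel A (.var 0)))
    (hA' : (Tm.Gel A (.var 0)).inst (.var 0) = .Gel A (.var 0) := by rfl) :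
    EqTm Γ (.ung (.bapp (Tm.blam a).shift (.var 0))) (.ung a) A :=
  .ung (hA.symm ▸ .bridge_beta' hΓ.name isName_zero ha (rename_upr_inst_zero a) hA')

/-! ### The map `forg` -/

theorem forg_type (hΓ : Wf Γ) (hx : Γ.IsName x) {g : Tm} (hg : HasTy Γ g (.Gel .Nm (.var x))) :
    HasTy Γ (forg (.var x) g) .Nm :=
  have h := hΓ.restr hx
  .extent (A := .Gel .Nm (.var 0)) (B := .Nm) (l := 0) hx (GelNm_type h.name isName_zero)
    (.Nm (h.name.tmGelNm isName_zero)) (ung_bapp_type h.tmBridgeGel.name (k := 1) rfl) hg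

/-- `forg x (a x) = ung (λ y. a y)` -/
theorem forg_beta (hΓ : Wf Γ) (hx : Γ.IsName x) {a g : Tm}
    (ha : HasTy (Γ.restr x).name a (.Gel .Nm (.var 0)))
    (ha' : HasTy (Γ.snoc .removed).name (a.rename (upr fun n => n + 1)) (.Gel .Nm (.var 0)))
    (hg : a.inst (.var x) = g) : EqTm Γ (forg (.var x) g) (.ung a) .Nm := by
  have h := hΓ.restr hx
  subst hg
  exact .trans (.extent_beta (A := .Gel .Nm (.var 0)) (B := .Nm) (l := 0) hΓ hx
    (GelNm_type h.name isName_zero) (.Nm (h.name.tmGelNm isName_zero))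
    (ung_bapp_type h.tmBridgeGel.name (k := 1) rfl) ha) (ung_bapp_blam hΓ rfl ha')

theorem bapp_var_GelNm (hΓ : Wf Γ) (hx : Γ.IsName x) {k : ℕ}
    (hk : (Γ.restr x).vars[k]? = some (.tm bridgeGel)) :
    HasTy Γ (.bapp (.var k) (.var x)) (.Gel .Nm (.var x)) :=
  bapp_var_type hΓ hx hk rfl rfl

/-- `forg x (g' x) = ung g'`, which is fresh for `x`. -/
theorem forg_bapp (hΓ : Wf Γ) (hx : Γ.IsName x) {k : ℕ}
    (hk : (Γ.restr x).vars[k]? = some (.tm bridgeGel))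
    (hk' : Γ.vars[k]? = some (.tm bridgeGel)) :
    EqTm Γ (forg (.var x) (.bapp (.var k) (.var x))) (.ung (.bapp (.var (k + 1)) (.var 0))) .Nm :=
  forg_beta hΓ hx (bapp_var_GelNm (hΓ.restr hx).name isName_zero hk)
    (bapp_var_GelNm (k := k + 2) hΓ.removed.name isName_zero hk') rfl

theorem forg_gel_var (hΓ : Wf Γ) (hx : Γ.IsName x) {k : ℕ}
    (hk : (Γ.restr x).vars[k]? = some (.tm .Nm)) (hk' : Γ.vars[k]? = some (.tm .Nm)) :
    EqTm Γ (forg (.var x) (.gel (.var k) (.var x))) (.var k) .Nm :=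
  have h := hΓ.restr hx
  .trans (forg_beta (a := .gel (.var (k + 1)) (.var 0)) hΓ hx
    (gel_type h.name isName_zero (.var' h.removed hk))
    (gel_type (n := .var (k + 2)) hΓ.removed.name isName_zero (.var' hΓ.removed.removed hk')) rfl)
    (.Gel_beta (a := .var k) (.var' hΓ hk'))

/-! ### The map `loosen` at a bridge variable -/

/-- `ext (λ h' y. loosen (ung h') y) x h : Nm` for `h : Gel (1 + Nm) x`. -/
def loosenAt (x : ℕ) (h : Tm) : Tm :=
  .extent (.bapp (.app loosen (.ung (.bapp (.var 2) (.var 0)))) (.var 0)) (.var x) h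

theorem loosenAt_body_type (hΓ : Wf Γ) :
    HasTy (Γ.tm bridgeGelSum).name
      (.bapp (.app loosen (.ung (.bapp (.var 2) (.var 0)))) (.var 0)) .Nm :=
  have h := hΓ.tmBridgeGelSum
  .bapp' h.name isName_zero (app_loosen_type h.removed
    (.ung (bapp_var_type h.removed.name isName_zero rfl rfl rfl)))

theorem loosenAt_type (hΓ : Wf Γ) (hx : Γ.IsName x) {g : Tm}
    (hg : HasTy Γ g (.Gel onePlusNm (.var x))) : HasTy Γ (loosenAt x g) .Nm :=
  have h := hΓ.restr hx
  .extent (A := .Gel onePlusNm (.var 0)) (B := .Nm) (l := 0) hx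
    (GelOnePlusNm_type h.name isName_zero) (.Nm (h.name.tmGelOnePlusNm isName_zero))
    (loosenAt_body_type h) hg

theorem loosenAt_congr (hΓ : Wf Γ) (hx : Γ.IsName x) {g g' : Tm}
    (hg : EqTm Γ g g' (.Gel onePlusNm (.var x))) : EqTm Γ (loosenAt x g) (loosenAt x g') .Nm :=
  have h := hΓ.restr hx
  .extent (A := .Gel onePlusNm (.var 0)) (B := .Nm) (l := 0) hx
    (GelOnePlusNm_type h.name isName_zero) (.Nm (h.name.tmGelOnePlusNm isName_zero))
    (.refl (loosenAt_body_type h)) hg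

/-- `loosenAt x (a x) = loosen (ung (λ y. a y)) x` -/
theorem loosenAt_beta (hΓ : Wf Γ) (hx : Γ.IsName x) {a g : Tm}
    (ha : HasTy (Γ.restr x).name a (.Gel onePlusNm (.var 0)))
    (ha' : HasTy ((Γ.restr x).snoc .removed).name (a.rename (upr fun n => n + 1))
      (.Gel onePlusNm (.var 0))) (hg : a.inst (.var x) = g) :
    EqTm Γ (loosenAt x g) (.bapp (.app loosen (.ung a)) (.var x)) .Nm := by
  have h := hΓ.restr hx
  subst hg
  exact .trans (.extent_beta (A := .Gel onePlusNm (.var 0)) (B := .Nm) (l := 0) hΓ hx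
    (GelOnePlusNm_type h.name isName_zero) (.Nm (h.name.tmGelOnePlusNm isName_zero))
    (loosenAt_body_type h) ha)
    (.bapp' hΓ hx (app_loosen_congr h (ung_bapp_blam h rfl ha')))

theorem loosenAt_gel_inl (hΓ : Wf Γ) (hx : Γ.IsName x) :
    EqTm Γ (loosenAt x (.gel (.inl .star) (.var x))) (.cart (.var x)) .Nm := by
  have h := hΓ.restr hx
  have hi {Δ : Ctx} (hΔ : Wf Δ) : HasTy Δ (.inl .star) onePlusNm :=
    .inl (.star hΔ) (.Nm (l := 0) hΔ)
  refine .trans (loosenAt_beta (a := .gel (.inl .star) (.var 0)) hΓ hx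
    (gel_type h.name isName_zero (hi h.removed))
    (gel_type (n := .inl .star) h.removed.name isName_zero (hi h.removed.removed)) rfl) ?_
  refine .trans (.bapp' hΓ hx (.trans
    (app_loosen_congr h (.Gel_beta (a := .inl .star) (hi h))) (loosen_inl h (.star h)))) ?_
  exact .bridge_beta' hΓ hx (.cart h.name isName_zero)

theorem loosenAt_gel_inr (hΓ : Wf Γ) (hx : Γ.IsName x) {n : Tm} (hn : WkTy (Γ.restr x) n .Nm) :
    EqTm Γ (loosenAt x (.gel (.inr n) (.var x))) n .Nm := by
  have h := hΓ.restr hx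
  refine .trans (loosenAt_beta (a := .gel (.inr n.shift) (.var 0)) hΓ hx
    (gel_type h.name isName_zero (.inr (.unit (l := 0) h.removed) hn.ty₁))
    ?_ (congrArg (fun t => Tm.gel (.inr t) (.var x)) (shift_inst n (.var x)))) ?_
  · have e : (Tm.gel (.inr n.shift) (.var 0)).rename (upr fun n => n + 1) =
        .gel (.inr n.shift.shift) (.var 0) :=
      congrArg (fun t => Tm.gel (.inr t) (.var 0)) (rename_upr_shift n)
    rw [e]
    exact gel_type h.removed.name isName_zero (.inr (.unit (l := 0) h.removed.removed) hn.ty₂)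
  · have hi : HasTy (Γ.restr x) (.inr n) onePlusNm := .inr (.unit (l := 0) h) hn.ty
    refine .trans (.bapp' hΓ hx (.trans
      (app_loosen_congr h (.Gel_beta (a := .inr n) hi)) (loosen_inr h hn.ty))) ?_
    exact .bridge_beta' hΓ hx hn.ty_name (ht := shift_inst n (.var x))

/-! ### The round trip at a bridge variable -/

/-- `loosenAt x (tightenAt x m) : Nm`, the value at `x` of `loosen (tighten n')` if `m = n' x`. -/
def roundTrip (x : ℕ) (m : Tm) : Tm := loosenAt x (tightenAt x m)

theorem roundTrip_type (hΓ : Wf Γ) (hx : Γ.IsName x) {m : Tm} (hm : HasTy Γ m .Nm) :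
    HasTy Γ (roundTrip x m) .Nm :=
  loosenAt_type hΓ hx (tightenAt_type hΓ hx hm)

theorem roundTrip_congr (hΓ : Wf Γ) (hx : Γ.IsName x) {m m' : Tm} (hm : EqTm Γ m m' .Nm) :
    EqTm Γ (roundTrip x m) (roundTrip x m') .Nm :=
  loosenAt_congr hΓ hx (tightenAt_congr hΓ hx hm)

theorem roundTrip_cart (hΓ : Wf Γ) (hx : Γ.IsName x) :
    EqTm Γ (roundTrip x (.cart (.var x))) (.cart (.var x)) .Nm :=
  .trans (loosenAt_congr hΓ hx (tightenAt_cart hΓ hx)) (loosenAt_gel_inl hΓ hx)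

theorem roundTrip_fresh (hΓ : Wf Γ) (hx : Γ.IsName x) {n : Tm} (hn : WkTy (Γ.restr x) n .Nm) :
    EqTm Γ (roundTrip x n) n .Nm :=
  .trans (loosenAt_congr hΓ hx (tightenAt_fresh hΓ hx hn)) (loosenAt_gel_inr hΓ hx hn)

theorem eqNm_type (hΓ : Wf Γ) {a b : Tm} (ha : HasTy Γ a .Nm) (hb : HasTy Γ b .Nm) {l : ℕ} :
    HasTy Γ (.eq .Nm a b) (.univ l) :=
  .path (.Nm hΓ.dim) ha hb

theorem eqNm_congr (hΓ : Wf Γ) {a a' b b' : Tm} (ha : EqTm Γ a a' .Nm) (hb : EqTm Γ b b' .Nm) :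
    EqTm Γ (.eq .Nm a b) (.eq .Nm a' b') (.univ 0) :=
  .path (.refl (.Nm hΓ.dim)) ha hb

/-- `ext (λ g' y. λ i. ung g') x g`, a path from the round trip of `forg x g` to `forg x g`. -/
def forgPath (x : ℕ) (g : Tm) : Tm :=
  .extent (.plam (.ung (.bapp (.var 3) (.var 0)))) (.var x) g

/-- The type of `forgPath x g`. -/
def forgPathTy (x : ℕ) (g : Tm) : Tm :=
  .eq .Nm (roundTrip x (forg (.var x) g)) (forg (.var x) g)

theorem forgPathTy_type (hΓ : Wf Γ) (hx : Γ.IsName x) {g : Tm}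
    (hg : HasTy Γ g (.Gel .Nm (.var x))) : HasTy Γ (forgPathTy x g) (.univ 0) :=
  have h := forg_type hΓ hx hg
  eqNm_type hΓ (roundTrip_type hΓ hx h) h

/-- At a bridge `g'` the name `forg y (g' y)` equals the fresh name `ung g'`, on which the round
trip is judgmentally the identity. -/
theorem forgPath_body_type (hΓ : Wf Γ) :
    HasTy (Γ.tm bridgeGel).name (.plam (.ung (.bapp (.var 3) (.var 0))))
      (forgPathTy 0 (.bapp (.var 1) (.var 0))) := by
  have h := hΓ.tmBridgeGel
  have e := forg_bapp (k := 1) h.name isName_zero rfl rfl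
  refine .plam (A := .Nm) (ung_bapp_type h.name.dim rfl) (.symm ?_) (.symm e)
  exact .trans (roundTrip_congr h.name isName_zero e)
    (roundTrip_fresh h.name isName_zero (wkTy_ung_bapp (k := 1) h.removed rfl))

theorem forgPath_type (hΓ : Wf Γ) (hx : Γ.IsName x) {g : Tm}
    (hg : HasTy Γ g (.Gel .Nm (.var x))) : HasTy Γ (forgPath x g) (forgPathTy x g) :=
  have h := (hΓ.restr hx).name
  have h' := h.tmGelNm isName_zero
  .extent (A := .Gel .Nm (.var 0)) (B := forgPathTy 1 (.var 0)) (l := 0) hx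
    (GelNm_type h isName_zero) (forgPathTy_type h' isName_zero.succ (.var' h' rfl))
    (forgPath_body_type (hΓ.restr hx)) hg

/-- On fresh names `forgPath` is a constant path; stated for variables, as needed for the fibers of
`loosen`. -/
theorem forgPath_gel_var (hΓ : Wf Γ) (hx : Γ.IsName x) {k : ℕ}
    (hk : (Γ.restr x).vars[k]? = some (.tm .Nm)) (hk' : Γ.vars[k]? = some (.tm .Nm)) :
    EqTm Γ (forgPath x (.gel (.var k) (.var x))) (.plam (.var (k + 1)))
      (.eq .Nm (.var k) (.var k)) := by
  have h := (hΓ.restr hx).name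
  have h' := h.tmGelNm isName_zero
  have e₁ := forg_gel_var hΓ hx hk hk'
  have e₂ := roundTrip_fresh hΓ hx (wkTy_var (hΓ.restr hx) hk)
  refine .trans (.conv (.extent_beta (A := .Gel .Nm (.var 0)) (B := forgPathTy 1 (.var 0)) (l := 0)
    (a := .gel (.var (k + 1)) (.var 0)) hΓ hx
    (GelNm_type h isName_zero) (forgPathTy_type h' isName_zero.succ (.var' h' rfl))
    (forgPath_body_type (hΓ.restr hx))
    (gel_type h isName_zero (.var' (hΓ.restr hx).removed hk)))
    (eqNm_congr hΓ (.trans (roundTrip_congr hΓ hx e₁) e₂) e₁)) ?_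
  exact .plam (A := .Nm) (ung_bapp_blam_gel hΓ.dim (wkTy_var (k := k + 1) hΓ.dim hk'))
    (ung_bapp_blam_gel hΓ (wkTy_var hΓ hk')) (ung_bapp_blam_gel hΓ (wkTy_var hΓ hk'))

/-- Name induction provides a path from the round trip of any name `m` to `m`. -/
def namePath (x : ℕ) (m : Tm) : Tm :=
  .indNm (.var x) m (.plam (.cart (.var (x + 1)))) (forgPath (x + 1) (.var 0))

theorem plam_cart_type (hΓ : Wf Γ) (hx : Γ.IsName x) :
    HasTy Γ (.plam (.cart (.var (x + 1)))) (.eq .Nm (.cart (.var x)) (.cart (.var x))) :=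
  .plam (A := .Nm) (.cart hΓ.dim hx.succ) (.refl (.cart hΓ hx)) (.refl (.cart hΓ hx))

/-- The motive and the two branches of the name induction in `namePath`. -/
theorem namePath_aux (hΓ : Wf Γ) (hx : Γ.IsName x) :
    HasTy (Γ.tm .Nm) (.eq .Nm (roundTrip (x + 1) (.var 0)) (.var 0)) (.univ 0) ∧
    HasTy Γ (.plam (.cart (.var (x + 1))))
      (.eq .Nm (roundTrip x (.cart (.var x))) (.cart (.var x))) ∧
    HasTy (Γ.tm (.Gel .Nm (.var x))) (forgPath (x + 1) (.var 0)) (forgPathTy (x + 1) (.var 0)) :=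
  have h := hΓ.tmNm
  have h' := hΓ.tmGelNm hx
  ⟨eqNm_type h (roundTrip_type h hx.succ (.var' h rfl)) (.var' h rfl),
    .conv (plam_cart_type hΓ hx)
      (eqNm_congr hΓ (.symm (roundTrip_cart hΓ hx)) (.refl (.cart hΓ hx))),
    forgPath_type h' hx.succ (.var' h' rfl)⟩

theorem namePath_type (hΓ : Wf Γ) (hx : Γ.IsName x) {m : Tm} (hm : HasTy Γ m .Nm) :
    HasTy Γ (namePath x m) (.eq .Nm (roundTrip x m) m) :=
  have ⟨h, h₀, h₁⟩ := namePath_aux hΓ hx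
  .indNm (B := .eq .Nm (roundTrip (x + 1) (.var 0)) (.var 0)) hx hm h h₀ h₁

theorem namePath_congr (hΓ : Wf Γ) (hx : Γ.IsName x) {m m' : Tm} (hm : EqTm Γ m m' .Nm) :
    EqTm Γ (namePath x m) (namePath x m') (.eq .Nm (roundTrip x m) m) :=
  have ⟨h, h₀, h₁⟩ := namePath_aux hΓ hx
  .indNm (B := .eq .Nm (roundTrip (x + 1) (.var 0)) (.var 0)) hx hm h (.refl h₀) (.refl h₁)

theorem namePath_cart (hΓ : Wf Γ) (hx : Γ.IsName x) :
    EqTm Γ (namePath x (.cart (.var x))) (.plam (.cart (.var (x + 1))))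
      (.eq .Nm (.cart (.var x)) (.cart (.var x))) :=
  have ⟨h, h₀, h₁⟩ := namePath_aux hΓ hx
  .conv (.Nm_beta₀ (B := .eq .Nm (roundTrip (x + 1) (.var 0)) (.var 0)) hx h h₀ h₁)
    (eqNm_congr hΓ (roundTrip_cart hΓ hx) (.refl (.cart hΓ hx)))

theorem namePath_var (hΓ : Wf Γ) (hx : Γ.IsName x) {k : ℕ}
    (hk : (Γ.restr x).vars[k]? = some (.tm .Nm)) (hk' : Γ.vars[k]? = some (.tm .Nm)) :
    EqTm Γ (namePath x (.var k)) (.plam (.var (k + 1))) (.eq .Nm (.var k) (.var k)) :=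
  have ⟨h, h₀, h₁⟩ := namePath_aux hΓ hx
  have hn := wkTy_var (hΓ.restr hx) hk
  .trans (.conv
    (.Nm_beta₁ (B := .eq .Nm (roundTrip (x + 1) (.var 0)) (.var 0)) hx h h₀ h₁ hn.ty)
    (eqNm_congr hΓ (roundTrip_fresh hΓ hx hn) (.refl (.var' hΓ hk'))))
    (forgPath_gel_var hΓ hx hk hk')

/-! ### The path from `loosen (tighten n')` to `n'` -/

theorem eqOnePlusNm_type (hΓ : Wf Γ) {a b : Tm} (ha : HasTy Γ a onePlusNm)
    (hb : HasTy Γ b onePlusNm) {l : ℕ} : HasTy Γ (.eq onePlusNm a b) (.univ l) :=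
  .path (onePlusNm_type hΓ.dim) ha hb

theorem eqBridgeNm_type (hΓ : Wf Γ) {a b : Tm} (ha : HasTy Γ a bridgeNm)
    (hb : HasTy Γ b bridgeNm) {l : ℕ} : HasTy Γ (.eq bridgeNm a b) (.univ l) :=
  .path (bridgeNm_type hΓ.dim) ha hb

theorem eqBridgeNm_congr (hΓ : Wf Γ) {a a' b b' : Tm} (ha : EqTm Γ a a' bridgeNm)
    (hb : EqTm Γ b b' bridgeNm) :
    EqTm Γ (.eq bridgeNm a b) (.eq bridgeNm a' b') (.univ 0) :=
  .path (.refl (bridgeNm_type hΓ.dim)) ha hb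

theorem papp_eq_type {A a b p r : Tm} (hp : HasTy Γ p (.eq A a b)) (hr : IsDim Γ r) :
    HasTy Γ (.papp p r) A := by
  have h := HasTy.papp hp hr
  rwa [shift_inst] at h

theorem papp_eq_congr {A a b p p' r : Tm} (hp : EqTm Γ p p' (.eq A a b)) (hr : IsDim Γ r) :
    EqTm Γ (.papp p r) (.papp p' r) A := by
  have h := EqTm.papp hp hr hr (.refl hr)
  rwa [shift_inst] at h

theorem papp_eq_i0 {A a b p : Tm} (hp : HasTy Γ p (.eq A a b)) : EqTm Γ (.papp p .i0) a A := by
  have h := EqTm.papp_i0 hp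
  rwa [shift_inst] at h

theorem papp_eq_i1 {A a b p : Tm} (hp : HasTy Γ p (.eq A a b)) : EqTm Γ (.papp p .i1) b A := by
  have h := EqTm.papp_i1 hp
  rwa [shift_inst] at h

theorem blam_cart_type (hΓ : Wf Γ) : HasTy Γ (.blam (.cart (.var 0))) bridgeNm :=
  .blam (.cart hΓ.name isName_zero)

/-- `λ n'. λ i. λ x. namePath x (n' x) i`, a homotopy from `loosen ∘ tighten` to the identity. -/
def counit : Tm :=
  .lam (.plam (.blam (.papp (namePath 0 (.bapp (.var 2) (.var 0))) (.var 1))))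

/-- The type `loosen (tighten n) ≡ n`. -/
def counitTy (n : Tm) : Tm := .eq bridgeNm (.app loosen (.app tighten n)) n

theorem loosen_tighten_type (hΓ : Wf Γ) {n : Tm} (hn : HasTy Γ n bridgeNm) :
    HasTy Γ (.app loosen (.app tighten n)) bridgeNm :=
  app_loosen_type hΓ (app_tighten_type hΓ hn)

/-- `λ x. roundTrip x (n' x) = loosen (tighten n')` for a variable `n'`. -/
theorem blam_roundTrip (hΓ : Wf Γ) {k : ℕ} (hk : Γ.vars[k]? = some (.tm bridgeNm)) :
    EqTm Γ (.blam (roundTrip 0 (.bapp (.var (k + 1)) (.var 0))))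
      (.app loosen (.app tighten (.var k))) bridgeNm := by
  have hN := hΓ.name
  have hb {Δ : Ctx} (hΔ : Wf Δ) {j : ℕ} (hj : Δ.vars[j]? = some (.tm bridgeNm)) :
      HasTy Δ.name (roundTrip 0 (.bapp (.var (j + 1)) (.var 0))) .Nm :=
    roundTrip_type hΔ.name isName_zero (bapp_var_Nm hΔ.name isName_zero hj)
  have ht {Δ : Ctx} (hΔ : Wf Δ) {j : ℕ} (hj : Δ.vars[j]? = some (.tm bridgeNm)) :
      HasTy Δ.name (tightenAt 0 (.bapp (.var (j + 1)) (.var 0))) (.Gel onePlusNm (.var 0)) :=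
    tightenAt_type hΔ.name isName_zero (bapp_var_Nm hΔ.name isName_zero hj)
  refine .bridge_eta (.blam (hb hΓ hk)) (loosen_tighten_type hΓ (.var' hΓ hk)) ?_
  refine .trans (.bridge_beta' hN isName_zero (hb (j := k + 1) hΓ.removed hk)) ?_
  refine .trans (loosenAt_beta (a := tightenAt 0 (.bapp (.var (k + 2)) (.var 0))) hN isName_zero
    (ht (j := k + 1) hΓ.removed hk) (ht (j := k + 2) hΓ.removed.removed hk) rfl) ?_
  exact .bapp' hN isName_zero (app_loosen_congr hΓ.removed
    (.symm (app_tighten hΓ.removed (n := .var (k + 1)) (.var' hΓ.removed hk))))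

theorem counit_body_type (hΓ : Wf Γ) :
    HasTy (Γ.tm bridgeNm) (.plam (.blam (.papp (namePath 0 (.bapp (.var 2) (.var 0))) (.var 1))))
      (counitTy (.var 0)) := by
  have h := hΓ.tmBridgeNm
  have hp {Δ : Ctx} (hΔ : Wf Δ) {j : ℕ} (hj : Δ.vars[j]? = some (.tm bridgeNm)) :=
    namePath_type hΔ.name isName_zero (bapp_var_Nm (k := j + 1) hΔ.name isName_zero hj)
  have hn : HasTy (Γ.tm bridgeNm) (.var 0) bridgeNm := .var' h rfl
  refine .plam (A := bridgeNm) (.blam (papp_eq_type (hp (j := 1) h.dim rfl) (.var rfl))) ?_ ?_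
  · exact .trans (.blam (papp_eq_i0 (hp (j := 0) h rfl))) (blam_roundTrip h rfl)
  · refine .trans (.blam (papp_eq_i1 (hp (j := 0) h rfl))) ?_
    refine .bridge_eta (.blam (bapp_var_Nm h.name isName_zero rfl)) hn ?_
    exact .bridge_beta' h.name isName_zero (bapp_var_Nm h.removed.name isName_zero rfl)

theorem counit_type (hΓ : Wf Γ) : HasTy Γ counit (.pi bridgeNm (counitTy (.var 0))) :=
  .lam (bridgeNm_type (l := 0) hΓ) (counit_body_type hΓ)

theorem app_counit_type (hΓ : Wf Γ) {n : Tm} (hn : HasTy Γ n bridgeNm) :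
    HasTy Γ (.app counit n) (counitTy n) :=
  .app' (counit_type hΓ) hn

/-- `counit` is constant at the identity bridge. -/
theorem counit_blam_cart (hΓ : Wf Γ) :
    EqTm Γ (.app counit (.blam (.cart (.var 0)))) (.plam (.blam (.cart (.var 0))))
      (.eq bridgeNm (.blam (.cart (.var 0))) (.blam (.cart (.var 0)))) := by
  have hc {Δ : Ctx} (hΔ : Wf Δ) : HasTy Δ (.blam (.cart (.var 0))) bridgeNm :=
    .blam (.cart hΔ.name rfl)
  have key {Δ : Ctx} (hΔ : Wf Δ) {r : Tm} (hr : IsDim Δ.name r) :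
      EqTm Δ (.blam (.papp (namePath 0 (.bapp (.blam (.cart (.var 0))) (.var 0))) r))
        (.blam (.cart (.var 0))) bridgeNm := by
    have h := hΔ.name
    have e : EqTm Δ.name (.bapp (.blam (.cart (.var 0))) (.var 0)) (.cart (.var 0)) .Nm :=
      .bridge_beta' h isName_zero (.cart hΔ.removed.name rfl)
    refine .blam (.trans (papp_eq_congr (.trans (.conv (namePath_congr h isName_zero e)
      (eqNm_congr h (.trans (roundTrip_congr h isName_zero e) (roundTrip_cart h isName_zero)) e))
      (namePath_cart h isName_zero)) hr) ?_)
    exact .path_beta (A := .Nm) (.cart h.dim rfl) hr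
  have e : EqTm Γ (.app loosen (.app tighten (.blam (.cart (.var 0))))) (.blam (.cart (.var 0)))
      bridgeNm :=
    .trans (app_loosen_congr hΓ (tighten_blam_cart hΓ)) (loosen_inl hΓ (.star hΓ))
  refine .trans (.conv (.pi_beta (counit_body_type hΓ) (hc hΓ))
    (eqBridgeNm_congr hΓ e (.refl (hc hΓ)))) ?_
  exact .plam (A := bridgeNm) (key hΓ.dim (.var rfl)) (key hΓ .i0) (key hΓ .i1)

/-- `counit` is constant at a constant bridge. -/
theorem counit_blam_var (hΓ : Wf Γ) {k : ℕ} (hk : Γ.vars[k]? = some (.tm .Nm)) :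
    EqTm Γ (.app counit (.blam (.var (k + 1)))) (.plam (.blam (.var (k + 2))))
      (.eq bridgeNm (.blam (.var (k + 1))) (.blam (.var (k + 1)))) := by
  have hc {Δ : Ctx} (hΔ : Wf Δ) {j : ℕ} (hj : Δ.vars[j]? = some (.tm .Nm)) :
      HasTy Δ (.blam (.var (j + 1))) bridgeNm := .blam (.var' hΔ.name hj)
  have key {Δ : Ctx} (hΔ : Wf Δ) {j : ℕ} (hj : Δ.vars[j]? = some (.tm .Nm)) {r : Tm}
      (hr : IsDim Δ.name r) :
      EqTm Δ (.blam (.papp (namePath 0 (.bapp (.blam (.var (j + 2))) (.var 0))) r))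
        (.blam (.var (j + 1))) bridgeNm := by
    have h := hΔ.name
    have e := bapp_blam_var (k := j + 1) h isName_zero hj
    refine .blam (.trans (papp_eq_congr (.trans (.conv (namePath_congr h isName_zero e)
      (eqNm_congr h (.trans (roundTrip_congr h isName_zero e)
        (roundTrip_fresh h isName_zero (wkTy_var (k := j + 1) hΔ.removed hj))) e))
      (namePath_var h isName_zero hj hj)) hr) ?_)
    exact .path_beta (A := .Nm) (.var' (n := j + 2) h.dim hj) hr
  have e : EqTm Γ (.app loosen (.app tighten (.blam (.var (k + 1))))) (.blam (.var (k + 1)))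
      bridgeNm :=
    .trans (app_loosen_congr hΓ (tighten_blam_var hΓ hk)) (loosen_inr hΓ (.var' hΓ hk))
  refine .trans (.conv (.pi_beta (counit_body_type hΓ) (hc hΓ hk))
    (eqBridgeNm_congr hΓ e (.refl (hc hΓ hk)))) ?_
  exact .plam (A := bridgeNm) (key (j := k + 1) hΓ.dim hk (.var rfl)) (key hΓ hk .i0)
    (key hΓ hk .i1)

/-! ### The path from `tighten (loosen s)` to `s` -/

/-- The type `tighten (loosen s) ≡ s`. -/
def unitTy (s : Tm) : Tm := .eq onePlusNm (.app tighten (.app loosen s)) s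

theorem unitTy_type (hΓ : Wf Γ) {s : Tm} (hs : HasTy Γ s onePlusNm) {l : ℕ} :
    HasTy Γ (unitTy s) (.univ l) :=
  eqOnePlusNm_type hΓ (app_tighten_type hΓ (app_loosen_type hΓ hs)) hs

/-- Constant paths `tighten (loosen s) ≡ s`, by case analysis on `s`. -/
def unitPath : Tm :=
  .lam (.case (.var 0) (.plam (.inl (.var 1))) (.plam (.inr (.var 1))))

theorem unitPath_type (hΓ : Wf Γ) :
    HasTy Γ unitPath (.pi onePlusNm (unitTy (.var 0))) := by
  have h := hΓ.tmOnePlusNm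
  have hu {Δ : Ctx} (hΔ : Wf Δ) {k : ℕ} (hk : Δ.vars[k]? = some (.tm .unit)) :
      HasTy Δ (.inl (.var k)) onePlusNm := .inl (.var' hΔ hk) (.Nm (l := 0) hΔ)
  have hn {Δ : Ctx} (hΔ : Wf Δ) {k : ℕ} (hk : Δ.vars[k]? = some (.tm .Nm)) :
      HasTy Δ (.inr (.var k)) onePlusNm := .inr (.unit (l := 0) hΔ) (.var' hΔ hk)
  refine .lam (onePlusNm_type (l := 0) hΓ) (.case (l := 0) (C := unitTy (.var 0)) (A := .unit)
    (B := .Nm) (.var' h rfl) (unitTy_type h.tmOnePlusNm (.var' h.tmOnePlusNm rfl)) ?_ ?_)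
  · exact .plam (A := onePlusNm) (hu h.tmUnit.dim rfl)
      (.symm (tighten_loosen_inl h.tmUnit (.var' h.tmUnit rfl))) (.refl (hu h.tmUnit rfl))
  · exact .plam (A := onePlusNm) (hn h.tmNm.dim rfl)
      (.symm (tighten_loosen_inr h.tmNm rfl)) (.refl (hn h.tmNm rfl))

/-! ### Every bridge of names is the identity or constant -/

/-- `((λ x. c x) ≡ n') + (Σ (n : Nm), (λ _. n) ≡ n')` for the variable `n'` of index `k`. -/
def decompTy (k : ℕ) : Tm :=
  .sum (.eq bridgeNm (.blam (.cart (.var 0))) (.var k))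
    (.sigma .Nm (.eq bridgeNm (.blam (.var 1)) (.var (k + 1))))


theorem decompTy_sigma_type (hΓ : Wf Γ) {k : ℕ} (hk : Γ.vars[k]? = some (.tm bridgeNm)) :
    HasTy (Γ.tm .Nm) (.eq bridgeNm (.blam (.var 1)) (.var (k + 1))) (.univ 0) :=
  have h := hΓ.tmNm
  eqBridgeNm_type h (.blam (.var' h.name rfl)) (.var' h hk)

theorem decompTy_type (hΓ : Wf Γ) {k : ℕ} (hk : Γ.vars[k]? = some (.tm bridgeNm)) :
    HasTy Γ (decompTy k) (.univ 0) :=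
  .sum (eqBridgeNm_type hΓ (blam_cart_type hΓ) (.var' hΓ hk))
    (.sigma (.Nm hΓ) (decompTy_sigma_type hΓ hk))

/-- Case analysis on `tighten n'`, abstracted over a path `loosen (tighten n') ≡ n'`. -/
def decomp : Tm :=
  .lam (.app (.case (.app tighten (.var 0)) (.lam (.inl (.var 0)))
    (.lam (.inr (.pair (.var 1) (.var 0))))) (.app counit (.var 0)))

theorem decomp_type (hΓ : Wf Γ) : HasTy Γ decomp (.pi bridgeNm (decompTy 0)) := by
  have h := hΓ.tmBridgeNm
  have hq {Δ : Ctx} (hΔ : Wf Δ) {s : Tm} (hs : HasTy Δ s onePlusNm) {k : ℕ}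
      (hk : Δ.vars[k]? = some (.tm bridgeNm)) :
      HasTy Δ (.eq bridgeNm (.app loosen s) (.var k)) (.univ 0) :=
    eqBridgeNm_type hΔ (app_loosen_type hΔ hs) (.var' hΔ hk)
  have h₀ := h.tmOnePlusNm
  have hq₀ := hq h₀ (s := .var 0) (.var' h₀ rfl) (k := 1) rfl
  have h₁ := h.tmUnit
  have hq₁ := hq h₁ (s := .inl (.var 0)) (.inl (.var' h₁ rfl) (.Nm (l := 0) h₁)) (k := 1) rfl
  have h₁' := h₁.tm hq₁
  have h₂ := h.tmNm
  have hq₂ := hq h₂ (s := .inr (.var 0)) (.inr (.unit (l := 0) h₂) (.var' h₂ rfl)) (k := 1) rfl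
  have h₂' := h₂.tm hq₂
  refine .lam (bridgeNm_type (l := 0) hΓ) (.app' (B := decompTy 1) (.case (l := 0)
    (C := .pi (.eq bridgeNm (.app loosen (.var 0)) (.var 1)) (decompTy 2)) (A := .unit) (B := .Nm)
    (app_tighten_type h (.var' h rfl)) (.pi hq₀ (decompTy_type (h₀.tm hq₀) rfl))
    (.lam (l := 0) hq₁ ?_) (.lam (l := 0) hq₂ ?_)) (app_counit_type h (.var' h rfl)))
  · have hv : HasTy _ (.var 2) bridgeNm := .var' h₁' rfl
    have e := loosen_inl h₁' (u := .var 1) (.var' h₁' rfl)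
    exact .inl (.conv (.var' h₁' rfl) (eqBridgeNm_congr h₁' e (.refl hv)))
      (.sigma (.Nm (l := 0) h₁') (decompTy_sigma_type h₁' (k := 2) rfl))
  · have hv : HasTy _ (.var 2) bridgeNm := .var' h₂' rfl
    have e := loosen_inr h₂' (n := .var 1) (.var' h₂' rfl)
    exact .inr (eqBridgeNm_type (l := 0) h₂' (blam_cart_type h₂') hv)
      (.pair (.Nm (l := 0) h₂') (decompTy_sigma_type h₂' (k := 2) rfl) (.var' h₂' rfl)
        (.conv (.var' h₂' rfl) (eqBridgeNm_congr h₂' e (.refl hv))))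

/-! ### Dimensions and their equality -/

theorem IsDim.cof {r e e' : Tm} (h : IsDim Γ r) : IsDim (Γ.cof e e') r := by
  cases h with
  | i0 => exact .i0
  | i1 => exact .i1
  | var h => exact .var h

theorem IsDim.shift {r : Tm} (h : IsDim Γ r) (e : Entry) : IsDim (Γ.snoc e) r.shift := by
  cases h with
  | i0 => exact .i0
  | i1 => exact .i1
  | var h => exact .var h

theorem EqDim.shift {r s : Tm} (h : EqDim Γ r s) (e : Entry) :
    EqDim (Γ.snoc e) r.shift s.shift := by
  induction h with
  | hyp h => exact .hyp (List.mem_map_of_mem (f := fun c => (Tm.shift c.1, Tm.shift c.2)) h)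
  | refl h => exact .refl (h.shift e)
  | symm _ ih => exact .symm ih
  | trans _ _ ih₁ ih₂ => exact .trans ih₁ ih₂

theorem eqDim_cof {e e' : Tm} : EqDim (Γ.cof e e') e e' := .hyp (List.mem_cons_self ..)

theorem EqDim.cof {r s e e' : Tm} (h : EqDim Γ r s) : EqDim (Γ.cof e e') r s := by
  induction h with
  | hyp h => exact .hyp (List.mem_cons_of_mem _ h)
  | refl h => exact .refl h.cof
  | symm _ ih => exact .symm ih
  | trans _ _ ih₁ ih₂ => exact .trans ih₁ ih₂

/-! ### The connection of a path of bridges -/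

/-- The variables `p + 2, p + 1, p` are bridges `a, b` and a path `a ≡ b`. -/
structure HasPathVar (Γ : Ctx) (p : ℕ) : Prop where
  fst : Γ.vars[p + 2]? = some (.tm bridgeNm)
  snd : Γ.vars[p + 1]? = some (.tm bridgeNm)
  path : Γ.vars[p]? = some (.tm (.eq bridgeNm (.var 1) (.var 0)))

theorem HasPathVar.dim {p : ℕ} (h : HasPathVar Γ p) : HasPathVar Γ.dim (p + 1) :=
  ⟨h.fst, h.snd, h.path⟩

theorem HasPathVar.cof {p : ℕ} {e e' : Tm} (h : HasPathVar Γ p) : HasPathVar (Γ.cof e e') p :=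
  ⟨h.fst, h.snd, h.path⟩

theorem HasPathVar.fst_type {p : ℕ} (hp : HasPathVar Γ p) (hΓ : Wf Γ) :
    HasTy Γ (.var (p + 2)) bridgeNm := .var' hΓ hp.fst
theorem HasPathVar.path_type {p : ℕ} (hp : HasPathVar Γ p) (hΓ : Wf Γ) :
    HasTy Γ (.var p) (.eq bridgeNm (.var (p + 2)) (.var (p + 1))) := by
  refine .var' hΓ hp.path ?_
  have e : rename (fun m => m + (p + 1)) (.eq bridgeNm (.var 1) (.var 0)) =
    .eq bridgeNm (.var (1 + (p + 1))) (.var (0 + (p + 1))) := rfl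
  rw [e, Nat.add_comm 1, Nat.zero_add]

/-- `hcom 0 → j` in `𝔸 ⊸ Nm` with cap `a` and tubes `k = 0 ↪ a` and `k = 1 ↪ p z`, where
`p : a ≡ b` are the variables `p, p + 2, p + 1`: the square which is `a` for `j = 0` or `k = 0`,
and `p j` for `k = 1`. -/
def fillTm (p : ℕ) (j k : Tm) : Tm :=
  .hcom bridgeNm .i0 j (.var (p + 2)) 2 (fun _ => k) ![.i0, .i1]
    ![.var (p + 3), .papp (.var (p + 1)) (.var 0)]

theorem subst_fillTm {σ : ℕ → Tm} {p q : ℕ} (h₀ : σ p = .var q) (h₂ : σ (p + 2) = .var (q + 2))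
    (j k : Tm) : (fillTm p j k).subst σ = fillTm q (j.subst σ) (k.subst σ) := by
  have h₀' : ups σ (p + 1) = .var (q + 1) := congrArg Tm.shift h₀
  have h₂' : ups σ (p + 3) = .var (q + 3) := congrArg Tm.shift h₂
  simp only [fillTm, subst, h₂, Tm.hcom.injEq, heq_eq_eq, true_and]
  refine ⟨rfl, ?_, ?_⟩ <;> funext i <;> fin_cases i
  · rfl
  · rfl
  · exact h₂'
  · exact congrArg (Tm.papp · (.var 0)) h₀'

theorem fillTm_type {p : ℕ} {j k : Tm} (hΓ : Wf Γ) (hp : HasPathVar Γ p)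
    (hj : IsDim Γ j) (hk : IsDim Γ k) : HasTy Γ (fillTm p j k) bridgeNm := by
  refine .hcom (l := 0) (bridgeNm_type hΓ) .i0 hj (hp.fst_type hΓ) (fun _ => hk) ?_ ?_ ?_ ?_
  · exact Fin.forall_fin_two.2 ⟨.i0, .i1⟩
  · refine Fin.forall_fin_two.2 ⟨?_, ?_⟩
    · have h := (hΓ.cof hk .i0).dim
      exact hp.cof.dim.fst_type h
    · have h := (hΓ.cof hk .i1).dim
      exact papp_eq_type (hp.cof.dim.path_type h) (.var rfl)
  · refine Fin.forall_fin_two.2 ⟨?_, ?_⟩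
    · exact .refl (hp.cof.fst_type (hΓ.cof hk .i0))
    · exact papp_eq_i0 (hp.cof.path_type (hΓ.cof hk .i1))
  · have ty₀ {Δ : Ctx} (hΔ : Wf Δ) (hp : HasPathVar Δ p) :=
      hp.dim.fst_type hΔ.dim
    have ty₁ {Δ : Ctx} (hΔ : Wf Δ) (hp : HasPathVar Δ p) :=
      papp_eq_type (hp.dim.path_type hΔ.dim) (.var rfl : IsDim Δ.dim (.var 0))
    have w {e e' : Tm} (he : IsDim Γ e) (he' : IsDim Γ e') : Wf ((Γ.cof k e).cof k e') :=
      (hΓ.cof hk he).cof hk.cof he'.cof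
    refine Fin.forall_fin_two.2 ⟨Fin.forall_fin_two.2 ⟨?_, ?_⟩, Fin.forall_fin_two.2 ⟨?_, ?_⟩⟩
    · exact .refl (ty₀ (w .i0 .i0) hp.cof.cof)
    · exact .absurd (.shift (.trans (.symm (.cof eqDim_cof)) eqDim_cof) _)
        (ty₀ (w .i0 .i1) hp.cof.cof) (ty₁ (w .i0 .i1) hp.cof.cof)
    · exact .absurd (.shift (.trans (.symm eqDim_cof) (.cof eqDim_cof)) _)
        (ty₁ (w .i1 .i0) hp.cof.cof) (ty₀ (w .i1 .i0) hp.cof.cof)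
    · exact .refl (ty₁ (w .i1 .i1) hp.cof.cof)

theorem fillTm_start {p : ℕ} {j k : Tm} (hΓ : Wf Γ) (hp : HasPathVar Γ p)
    (hj : IsDim Γ j) (hk : IsDim Γ k) (h : EqDim Γ .i0 j) :
    EqTm Γ (fillTm p j k) (.var (p + 2)) bridgeNm :=
  .hcom_refl (fillTm_type hΓ hp hj hk) h

theorem fillTm_i0 {p : ℕ} {j k : Tm} (hΓ : Wf Γ) (hp : HasPathVar Γ p)
    (hj : IsDim Γ j) (hk : IsDim Γ k) (h : EqDim Γ k .i0) :
    EqTm Γ (fillTm p j k) (.var (p + 2)) bridgeNm :=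
  .hcom_tube 0 (fillTm_type hΓ hp hj hk) h

theorem fillTm_i1 {p : ℕ} {j k : Tm} (hΓ : Wf Γ) (hp : HasPathVar Γ p)
    (hj : IsDim Γ j) (hk : IsDim Γ k) (h : EqDim Γ k .i1) :
    EqTm Γ (fillTm p j k) (.papp (.var p) j) bridgeNm :=
  .hcom_tube 1 (fillTm_type hΓ hp hj hk) h

theorem fillTm_congr {p : ℕ} {j k : Tm} (hΓ : Wf Γ) (hp : HasPathVar Γ p)
    (hj : IsDim Γ j) (hk : IsDim Γ k) {j' : Tm} (hj' : IsDim Γ j') (h : EqDim Γ j j') :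
    EqTm Γ (fillTm p j k) (fillTm p j' k) bridgeNm := by
  have hi : ∀ i : Fin 2, IsDim Γ ((![.i0, .i1] : Fin 2 → Tm) i) :=
    Fin.forall_fin_two.2 ⟨.i0, .i1⟩
  refine .hcom (l := 0) (fillTm_type hΓ hp hj hk) (fillTm_type hΓ hp hj' hk)
    (.refl (bridgeNm_type hΓ)) (.refl .i0) h (.refl (hp.fst_type hΓ)) (fun _ => .refl hk)
    (fun i => .refl (hi i)) ?_
  refine Fin.forall_fin_two.2 ⟨?_, ?_⟩
  · exact .refl (hp.cof.dim.fst_type (hΓ.cof hk .i0).dim)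
  · exact .refl (papp_eq_type (hp.cof.dim.path_type (hΓ.cof hk .i1).dim) (.var rfl))

/-- The connection of a path `p : a ≡ b`, a square which is `a` for `i = 0` or `j = 0`, `p j` for
`i = 1` and `p i` for `j = 1`. The cap is constant; the tubes at `i = 1` and `j = 1` are squares
`fillTm`, which agree where both are defined, as they depend on `j` and `i` in the same way. -/
def connTm (p : ℕ) (i j : Tm) : Tm :=
  .hcom bridgeNm .i0 .i1 (.var (p + 2)) 4 ![i, j, i, j] ![.i0, .i0, .i1, .i1]
    ![.var (p + 3), .var (p + 3), fillTm (p + 1) j.shift (.var 0),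
      fillTm (p + 1) i.shift (.var 0)]

theorem forall_fin_four {P : Fin 4 → Prop} : (∀ i, P i) ↔ P 0 ∧ P 1 ∧ P 2 ∧ P 3 := by
  simp [Fin.forall_fin_succ]

theorem fillTm_inst {p : ℕ} {j e : Tm} :
    (fillTm (p + 1) j.shift (.var 0)).inst e = fillTm p j e :=
  (subst_fillTm (σ := scons e var) (p := p + 1) (q := p) rfl rfl j.shift (.var 0)).trans
    (congrArg (fillTm p · e) (shift_inst j e))

theorem connTm_type {p : ℕ} {i j : Tm} (hΓ : Wf Γ) (hp : HasPathVar Γ p) (hi : IsDim Γ i)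
    (hj : IsDim Γ j) : HasTy Γ (connTm p i j) bridgeNm := by
  have ha {Δ : Ctx} (hΔ : Wf Δ) (hp : HasPathVar Δ p) := hp.dim.fst_type hΔ.dim
  have hf {Δ : Ctx} (hΔ : Wf Δ) (hp : HasPathVar Δ p) {r : Tm} (hr : IsDim Δ r) :=
    fillTm_type hΔ.dim hp.dim (hr.shift .dim) (.var rfl : IsDim Δ.dim (.var 0))
  have hcap {Δ : Ctx} (hΔ : Wf Δ) (hp : HasPathVar Δ p) {r : Tm} (hr : IsDim Δ r) :
      EqTm Δ ((fillTm (p + 1) r.shift (.var 0)).inst .i0) (.var (p + 2)) bridgeNm :=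
    fillTm_inst.symm ▸ fillTm_i0 hΔ hp hr .i0 (.refl .i0)
  have hf₀ {Δ : Ctx} (hΔ : Wf Δ) (hp : HasPathVar Δ p) {r : Tm} (hr : IsDim Δ r)
      (h : EqDim Δ r .i0) :=
    fillTm_start hΔ.dim hp.dim (hr.shift .dim) (.var rfl : IsDim Δ.dim (.var 0))
      (.symm (h.shift .dim))
  have w {r e r' e' : Tm} (hr : IsDim Γ r) (he : IsDim Γ e) (hr' : IsDim Γ r')
      (he' : IsDim Γ e') : Wf ((Γ.cof r e).cof r' e') :=
    (hΓ.cof hr he).cof hr'.cof he'.cof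
  have hp₂ {r e r' e' : Tm} : HasPathVar ((Γ.cof r e).cof r' e') p := hp.cof.cof
  have hi₂ {r e r' e' : Tm} : IsDim ((Γ.cof r e).cof r' e') i := hi.cof.cof
  have hj₂ {r e r' e' : Tm} : IsDim ((Γ.cof r e).cof r' e') j := hj.cof.cof
  have hd {r e r' e' : Tm} : EqDim ((Γ.cof r e).cof r' e') r e := eqDim_cof.cof
  refine .hcom (l := 0) (bridgeNm_type hΓ) .i0 .i1 (hp.fst_type hΓ)
    (forall_fin_four.2 ⟨hi, hj, hi, hj⟩) (forall_fin_four.2 ⟨.i0, .i0, .i1, .i1⟩)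
    (forall_fin_four.2 ⟨?_, ?_, ?_, ?_⟩) (forall_fin_four.2 ⟨?_, ?_, ?_, ?_⟩)
    (forall_fin_four.2 ⟨forall_fin_four.2 ⟨?_, ?_, ?_, ?_⟩, forall_fin_four.2 ⟨?_, ?_, ?_, ?_⟩,
      forall_fin_four.2 ⟨?_, ?_, ?_, ?_⟩, forall_fin_four.2 ⟨?_, ?_, ?_, ?_⟩⟩)
  · exact ha (hΓ.cof hi .i0) hp.cof
  · exact ha (hΓ.cof hj .i0) hp.cof
  · exact hf (hΓ.cof hi .i1) hp.cof hj.cof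
  · exact hf (hΓ.cof hj .i1) hp.cof hi.cof
  · exact .refl (hp.cof.fst_type (hΓ.cof hi .i0))
  · exact .refl (hp.cof.fst_type (hΓ.cof hj .i0))
  · exact hcap (hΓ.cof hi .i1) hp.cof hj.cof
  · exact hcap (hΓ.cof hj .i1) hp.cof hi.cof
  -- The sixteen overlaps of the tubes, in lexicographic order.
  · exact .refl (ha (w hi .i0 hi .i0) hp₂)
  · exact .refl (ha (w hi .i0 hj .i0) hp₂)
  · exact .absurd (.shift (.trans (.symm hd) eqDim_cof) _) (ha (w hi .i0 hi .i1) hp₂)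
      (hf (w hi .i0 hi .i1) hp₂ hj₂)
  · exact .symm (hf₀ (w hi .i0 hj .i1) hp₂ hi₂ hd)
  · exact .refl (ha (w hj .i0 hi .i0) hp₂)
  · exact .refl (ha (w hj .i0 hj .i0) hp₂)
  · exact .symm (hf₀ (w hj .i0 hi .i1) hp₂ hj₂ hd)
  · exact .absurd (.shift (.trans (.symm hd) eqDim_cof) _) (ha (w hj .i0 hj .i1) hp₂)
      (hf (w hj .i0 hj .i1) hp₂ hi₂)
  · exact .absurd (.shift (.trans (.symm eqDim_cof) hd) _) (hf (w hi .i1 hi .i0) hp₂ hj₂)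
      (ha (w hi .i1 hi .i0) hp₂)
  · exact hf₀ (w hi .i1 hj .i0) hp₂ hj₂ eqDim_cof
  · exact .refl (hf (w hi .i1 hi .i1) hp₂ hj₂)
  · exact fillTm_congr (w hi .i1 hj .i1).dim hp₂.dim (hj₂.shift _) (.var rfl) (hi₂.shift _)
      (.shift (.trans eqDim_cof (.symm hd)) _)
  · exact hf₀ (w hj .i1 hi .i0) hp₂ hi₂ eqDim_cof
  · exact .absurd (.shift (.trans (.symm eqDim_cof) hd) _) (hf (w hj .i1 hj .i0) hp₂ hi₂)
      (ha (w hj .i1 hj .i0) hp₂)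
  · exact fillTm_congr (w hj .i1 hi .i1).dim hp₂.dim (hi₂.shift _) (.var rfl) (hj₂.shift _)
      (.shift (.trans eqDim_cof (.symm hd)) _)
  · exact .refl (hf (w hj .i1 hj .i1) hp₂ hi₂)

theorem connTm_left {p : ℕ} {i j : Tm} (hΓ : Wf Γ) (hp : HasPathVar Γ p) (hi : IsDim Γ i)
    (hj : IsDim Γ j) (h : EqDim Γ i .i0) :
    EqTm Γ (connTm p i j) (.var (p + 2)) bridgeNm :=
  .hcom_tube 0 (connTm_type hΓ hp hi hj) h

theorem connTm_bot {p : ℕ} {i j : Tm} (hΓ : Wf Γ) (hp : HasPathVar Γ p) (hi : IsDim Γ i)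
    (hj : IsDim Γ j) (h : EqDim Γ j .i0) :
    EqTm Γ (connTm p i j) (.var (p + 2)) bridgeNm :=
  .hcom_tube 1 (connTm_type hΓ hp hi hj) h

theorem connTm_right {p : ℕ} {i j : Tm} (hΓ : Wf Γ) (hp : HasPathVar Γ p) (hi : IsDim Γ i)
    (hj : IsDim Γ j) (h : EqDim Γ i .i1) :
    EqTm Γ (connTm p i j) (.papp (.var p) j) bridgeNm :=
  .trans (.hcom_tube 2 (connTm_type hΓ hp hi hj) h)
    (fillTm_inst.symm ▸ fillTm_i1 hΓ hp hj .i1 (.refl .i1))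

theorem connTm_top {p : ℕ} {i j : Tm} (hΓ : Wf Γ) (hp : HasPathVar Γ p) (hi : IsDim Γ i)
    (hj : IsDim Γ j) (h : EqDim Γ j .i1) :
    EqTm Γ (connTm p i j) (.papp (.var p) i) bridgeNm :=
  .trans (.hcom_tube 3 (connTm_type hΓ hp hi hj) h)
    (fillTm_inst.symm ▸ fillTm_i1 hΓ hp hi .i1 (.refl .i1))

theorem subst_connTm {σ : ℕ → Tm} {p q : ℕ} (h₀ : σ p = .var q) (h₂ : σ (p + 2) = .var (q + 2))
    {i j i' j' : Tm} (hi : i.subst σ = i') (hj : j.subst σ = j')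
    (hi' : i.shift.subst (ups σ) = i'.shift) (hj' : j.shift.subst (ups σ) = j'.shift) :
    (connTm p i j).subst σ = connTm q i' j' := by
  have h₀' : ups σ (p + 1) = .var (q + 1) := congrArg Tm.shift h₀
  have h₂' : ups σ (p + 3) = .var (q + 3) := congrArg Tm.shift h₂
  have hf {r r' : Tm} (hr : r.shift.subst (ups σ) = r'.shift) :
      (fillTm (p + 1) r.shift (.var 0)).subst (ups σ) = fillTm (q + 1) r'.shift (.var 0) := by
    rw [subst_fillTm h₀' h₂', hr]
    rfl
  simp only [connTm, subst, h₂, Tm.hcom.injEq, heq_eq_eq, true_and]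
  refine ⟨rfl, ?_, ?_, ?_⟩ <;> funext t <;> fin_cases t
  · exact hi
  · exact hj
  · exact hi
  · exact hj
  · rfl
  · rfl
  · rfl
  · rfl
  · exact h₂'
  · exact h₂'
  · exact hf hj'
  · exact hf hi'

/-- The connection, as a closed term `Π a b, Π (p : a ≡ b), path (i. a ≡ p i) (λ _. a) p`. -/
def conn : Tm := .lam (.lam (.lam (.plam (.plam (connTm 2 (.var 1) (.var 0))))))

/-- The type of `conn`. -/
def connTy : Tm :=
  .pi bridgeNm (.pi bridgeNm (.pi (.eq bridgeNm (.var 1) (.var 0))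
    (.path (.eq bridgeNm (.var 3) (.papp (.var 1) (.var 0))) (.plam (.var 3)) (.var 0))))

theorem conn_type (hΓ : Wf Γ) : HasTy Γ conn connTy := by
  have h₁ := hΓ.tmBridgeNm.tmBridgeNm
  have hE := eqBridgeNm_type (l := 0) h₁ (a := .var 1) (b := .var 0) (.var' h₁ rfl) (.var' h₁ rfl)
  have h := h₁.tm hE
  have e₀ : (connTm 2 (.var 1) (.var 0)).inst .i0 = connTm 1 (.var 0) .i0 :=
    subst_connTm (σ := scons .i0 var) rfl rfl rfl rfl rfl rfl
  have e₁ : (connTm 2 (.var 1) (.var 0)).inst .i1 = connTm 1 (.var 0) .i1 :=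
    subst_connTm (σ := scons .i1 var) rfl rfl rfl rfl rfl rfl
  have e₂ : (Tm.plam (connTm 2 (.var 1) (.var 0))).inst .i0 = .plam (connTm 1 .i0 (.var 0)) :=
    congrArg Tm.plam (subst_connTm (σ := ups (scons .i0 var)) rfl rfl rfl rfl rfl rfl)
  have e₃ : (Tm.plam (connTm 2 (.var 1) (.var 0))).inst .i1 = .plam (connTm 1 .i1 (.var 0)) :=
    congrArg Tm.plam (subst_connTm (σ := ups (scons .i1 var)) rfl rfl rfl rfl rfl rfl)
  have e₄ : (connTm 1 .i0 (.var 0)).inst .i0 = connTm 0 .i0 .i0 :=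
    subst_connTm (σ := scons .i0 var) rfl rfl rfl rfl rfl rfl
  have e₅ : (connTm 1 .i0 (.var 0)).inst .i1 = connTm 0 .i0 .i1 :=
    subst_connTm (σ := scons .i1 var) rfl rfl rfl rfl rfl rfl
  have e₆ : (connTm 1 .i1 (.var 0)).inst .i0 = connTm 0 .i1 .i0 :=
    subst_connTm (σ := scons .i0 var) rfl rfl rfl rfl rfl rfl
  have e₇ : (connTm 1 .i1 (.var 0)).inst .i1 = connTm 0 .i1 .i1 :=
    subst_connTm (σ := scons .i1 var) rfl rfl rfl rfl rfl rfl
  refine .lam (bridgeNm_type (l := 0) hΓ) (.lam (bridgeNm_type (l := 0) hΓ.tmBridgeNm)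
    (.lam hE (.plam (.plam (A := bridgeNm) ?_ ?_ ?_) ?_ ?_)))
  · exact connTm_type h.dim.dim ⟨rfl, rfl, rfl⟩ (.var rfl) (.var rfl)
  · rw [e₀]
    exact connTm_bot h.dim ⟨rfl, rfl, rfl⟩ (.var rfl) .i0 (.refl .i0)
  · rw [e₁]
    exact connTm_top h.dim ⟨rfl, rfl, rfl⟩ (.var rfl) .i1 (.refl .i1)
  · rw [e₂]
    refine .plam (A := bridgeNm)
      (connTm_left h.dim ⟨rfl, rfl, rfl⟩ .i0 (.var rfl) (.refl .i0)) ?_ ?_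
    · rw [e₄]
      exact connTm_left h ⟨rfl, rfl, rfl⟩ .i0 .i0 (.refl .i0)
    · rw [e₅]
      exact connTm_top h ⟨rfl, rfl, rfl⟩ .i0 .i1 (.refl .i1)
  · rw [e₃]
    have hv : HasTy ((Γ.tm bridgeNm).tm bridgeNm |>.tm (.eq bridgeNm (.var 1) (.var 0))) (.var 0)
      (.eq bridgeNm (.var 2) (.var 1)) := .var' h rfl
    have hw : HasTy ((Γ.tm bridgeNm).tm bridgeNm |>.tm (.eq bridgeNm (.var 1) (.var 0))).dim
      (.var 1) (.eq bridgeNm (.var 3) (.var 2)) := .var' h.dim rfl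
    have hv' := HasTy.conv hv (eqBridgeNm_congr h (.refl (.var' h rfl)) (.symm (papp_eq_i1 hv)))
    refine .trans (b := .plam (.papp (.var 1) (.var 0))) (.plam (A := bridgeNm)
      (connTm_right h.dim ⟨rfl, rfl, rfl⟩ .i1 (.var rfl) (.refl .i1)) ?_ ?_) ?_
    · rw [e₆]
      exact connTm_bot h ⟨rfl, rfl, rfl⟩ .i1 .i0 (.refl .i0)
    · rw [e₇]
      exact connTm_top h ⟨rfl, rfl, rfl⟩ .i1 .i1 (.refl .i1)
    -- `λ j. p j` is `p`; the two sides have the types `a ≡ p 1` and `a ≡ b`.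
    · refine .path_eta (.plam (A := bridgeNm) (papp_eq_type hw (.var rfl)) (papp_eq_i0 hv)
        (.refl (papp_eq_type hv .i1))) hv' ?_
      exact .path_beta (A := bridgeNm) (m := .papp (.var 2) (.var 0))
        (papp_eq_type (.var' h.dim.dim rfl : HasTy _ _ (.eq bridgeNm (.var 4) (.var 3)))
          (.var rfl)) (.var rfl)

/-! ### Non-dependent path types -/

theorem eq_type {A a b : Tm} {l : ℕ} (hA : HasTy Γ.dim A.shift (.univ l)) (ha : HasTy Γ a A)
    (hb : HasTy Γ b A) : HasTy Γ (.eq A a b) (.univ l) :=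
  .path hA ((shift_inst A .i0).symm ▸ ha) ((shift_inst A .i1).symm ▸ hb)

theorem eq_congr {A A' a a' b b' : Tm} {l : ℕ} (hA : EqTm Γ.dim A.shift A'.shift (.univ l))
    (ha : EqTm Γ a a' A) (hb : EqTm Γ b b' A) :
    EqTm Γ (.eq A a b) (.eq A' a' b') (.univ l) :=
  .path hA ((shift_inst A .i0).symm ▸ ha) ((shift_inst A .i1).symm ▸ hb)

theorem plam_eq_type {A a b m : Tm} (hm : HasTy Γ.dim m A.shift)
    (ha : EqTm Γ (m.inst .i0) a A) (hb : EqTm Γ (m.inst .i1) b A) :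
    HasTy Γ (.plam m) (.eq A a b) :=
  .plam hm ((shift_inst A .i0).symm ▸ ha) ((shift_inst A .i1).symm ▸ hb)

/-! ### Fibers of `loosen` -/

theorem fiber_snd_type (hΓ : Wf Γ) {f b : Tm} {l : ℕ}
    (hf : HasTy (Γ.tm onePlusNm) f.shift (.arrow onePlusNm bridgeNm))
    (hb : HasTy (Γ.tm onePlusNm) b.shift bridgeNm) :
    HasTy (Γ.tm onePlusNm) (.eq bridgeNm (.app f.shift (.var 0)) b.shift) (.univ l) :=
  eqBridgeNm_type hΓ.tmOnePlusNm (.app' hf (.var' hΓ.tmOnePlusNm rfl)) hb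

theorem fiber_type (hΓ : Wf Γ) {f b : Tm} {l : ℕ}
    (hf : HasTy (Γ.tm onePlusNm) f.shift (.arrow onePlusNm bridgeNm))
    (hb : HasTy (Γ.tm onePlusNm) b.shift bridgeNm) :
    HasTy Γ (.fiber onePlusNm bridgeNm f b) (.univ l) :=
  .sigma (onePlusNm_type hΓ) (fiber_snd_type hΓ hf hb)

/-- The fiber of `loosen` over `b`. -/
def fib (b : Tm) : Tm := .fiber onePlusNm bridgeNm loosen b

theorem fib_shift (b : Tm) : (fib b).shift = fib b.shift :=
  congrArg (fun t => Tm.sigma onePlusNm (.path bridgeNm (.app loosen (.var 0)) t))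
    (rename_upr_shift b)

/-- The type of the second component of a point of `fib b` with first component `s`. -/
theorem fib_snd_inst (b s : Tm) :
    (Tm.eq bridgeNm (.app loosen (.var 0)) b.shift).inst s = .eq bridgeNm (.app loosen s) b :=
  congrArg (fun t => Tm.path bridgeNm (.app loosen s) t) (shift_inst b s)

/-- `b : 𝔸 ⊸ Nm` holds in `Γ`, and in the extensions of `Γ` over which the fiber of `loosen`
over `b` and its path types are formed. -/
structure Base (Γ : Ctx) (b : Tm) : Prop where
  ty : HasTy Γ b bridgeNm
  ty_tm : HasTy (Γ.tm onePlusNm) b.shift bridgeNm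
  ty_dim : HasTy Γ.dim b.shift bridgeNm
  ty_dim_tm : HasTy (Γ.dim.tm onePlusNm) b.shift.shift bridgeNm

/-- The analogue of `Base` for `b = b'`. -/
structure BaseEq (Γ : Ctx) (b b' : Tm) : Prop where
  eq : EqTm Γ b b' bridgeNm
  eq_tm : EqTm (Γ.tm onePlusNm) b.shift b'.shift bridgeNm
  eq_dim_tm : EqTm (Γ.dim.tm onePlusNm) b.shift.shift b'.shift.shift bridgeNm

theorem fib_type (hΓ : Wf Γ) {b : Tm} {l : ℕ} (hb : HasTy (Γ.tm onePlusNm) b.shift bridgeNm) :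
    HasTy Γ (fib b) (.univ l) :=
  fiber_type hΓ (loosen_type hΓ.tmOnePlusNm) hb

theorem fib_congr (hΓ : Wf Γ) {b b' : Tm}
    (hb : EqTm (Γ.tm onePlusNm) b.shift b'.shift bridgeNm) : EqTm Γ (fib b) (fib b') (.univ 0) :=
  have h := hΓ.tmOnePlusNm
  .sigma (onePlusNm_type hΓ) (.refl (onePlusNm_type hΓ))
    (eqBridgeNm_congr h (.refl (app_loosen_type h (.var' h rfl))) hb)

theorem pair_fib_type (hΓ : Wf Γ) {b s q : Tm}
    (hb : HasTy (Γ.tm onePlusNm) b.shift bridgeNm) (hs : HasTy Γ s onePlusNm)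
    (hq : HasTy Γ q (.eq bridgeNm (.app loosen s) b)) : HasTy Γ (.pair s q) (fib b) :=
  .pair (onePlusNm_type (l := 0) hΓ) (fiber_snd_type hΓ (loosen_type hΓ.tmOnePlusNm) hb) hs
    ((fib_snd_inst b s).symm ▸ hq)

theorem pair_fib_congr (hΓ : Wf Γ) {b s s' q q' : Tm}
    (hb : HasTy (Γ.tm onePlusNm) b.shift bridgeNm) (hs : EqTm Γ s s' onePlusNm)
    (hq : EqTm Γ q q' (.eq bridgeNm (.app loosen s) b)) :
    EqTm Γ (.pair s q) (.pair s' q') (fib b) :=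
  .pair (onePlusNm_type (l := 0) hΓ) (fiber_snd_type hΓ (loosen_type hΓ.tmOnePlusNm) hb) hs
    ((fib_snd_inst b s).symm ▸ hq)

/-- The center of the fiber of `loosen` over `b`, `(tighten b, counit b)`. -/
def center (b : Tm) : Tm := .pair (.app tighten b) (.app counit b)

theorem center_type (hΓ : Wf Γ) {b : Tm} (hb : HasTy Γ b bridgeNm)
    (hb' : HasTy (Γ.tm onePlusNm) b.shift bridgeNm) : HasTy Γ (center b) (fib b) :=
  pair_fib_type hΓ hb' (app_tighten_type hΓ hb) (app_counit_type hΓ hb)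

/-- The type of paths from the center of the fiber over `b` to the point `(s, q)`. -/
def contrTy (b s q : Tm) : Tm := .eq (fib b) (center b) (.pair s q)

theorem app_counit_congr (hΓ : Wf Γ) {b b' : Tm} (hb : EqTm Γ b b' bridgeNm) :
    EqTm Γ (.app counit b) (.app counit b') (counitTy b) :=
  .app' (.refl (counit_type hΓ)) hb

theorem contrTy_type (hΓ : Wf Γ) {b s q : Tm} (hb : Base Γ b) (hs : HasTy Γ s onePlusNm)
    (hq : HasTy Γ q (.eq bridgeNm (.app loosen s) b)) : HasTy Γ (contrTy b s q) (.univ 0) :=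
  eq_type ((fib_shift b).symm ▸ fib_type hΓ.dim hb.ty_dim_tm) (center_type hΓ hb.ty hb.ty_tm)
    (pair_fib_type hΓ hb.ty_tm hs hq)

theorem contrTy_congr (hΓ : Wf Γ) {b b' s q q' : Tm} (hb : Base Γ b) (hbb : BaseEq Γ b b')
    (hs : HasTy Γ s onePlusNm) (hq : EqTm Γ q q' (.eq bridgeNm (.app loosen s) b)) :
    EqTm Γ (contrTy b s q) (contrTy b' s q') (.univ 0) :=
  eq_congr ((fib_shift b).symm ▸ (fib_shift b').symm ▸ fib_congr hΓ.dim hbb.eq_dim_tm)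
    (pair_fib_congr hΓ hb.ty_tm (app_tighten_congr hΓ hbb.eq) (app_counit_congr hΓ hbb.eq))
    (pair_fib_congr hΓ hb.ty_tm (.refl hs) hq)

theorem base_var (hΓ : Wf Γ) {k : ℕ} (hk : Γ.vars[k]? = some (.tm bridgeNm)) :
    Base Γ (.var k) :=
  ⟨.var' hΓ hk, .var' hΓ.tmOnePlusNm hk, .var' hΓ.dim hk, .var' hΓ.dim.tmOnePlusNm hk⟩

theorem base_loosen_var (hΓ : Wf Γ) {k : ℕ} (hk : Γ.vars[k]? = some (.tm onePlusNm)) :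
    Base Γ (.app loosen (.var k)) :=
  ⟨app_loosen_type hΓ (.var' hΓ hk),
    app_loosen_type (s := .var (k + 1)) hΓ.tmOnePlusNm (.var' hΓ.tmOnePlusNm hk),
    app_loosen_type (s := .var (k + 1)) hΓ.dim (.var' hΓ.dim hk),
    app_loosen_type (s := .var (k + 2)) hΓ.dim.tmOnePlusNm (.var' hΓ.dim.tmOnePlusNm hk)⟩

/-! ### Contraction of the fibers -/

/-- If `tighten (loosen s) = s` and `counit (loosen s)` is constant, then the center of the fiber
over `loosen s` is judgmentally `(s, refl)`, and the constant path joins the two. -/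
theorem contr_refl_type (hΓ : Wf Γ) {s : Tm} (hs : HasTy Γ s onePlusNm)
    (hs₁ : HasTy Γ.dim s.shift onePlusNm) (hs₂ : HasTy Γ.dim.dim s.shift.shift onePlusNm)
    (hs_tm : HasTy (Γ.tm onePlusNm) s.shift onePlusNm)
    (hs_dim_tm : HasTy (Γ.dim.tm onePlusNm) s.shift.shift onePlusNm)
    (e : EqTm Γ (.app tighten (.app loosen s)) s onePlusNm)
    (e' : EqTm Γ (.app counit (.app loosen s)) (.plam (.app loosen s.shift))
      (.eq bridgeNm (.app loosen s) (.app loosen s))) :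
    HasTy Γ (.plam (.pair s.shift (.plam (.app loosen s.shift.shift))))
      (contrTy (.app loosen s) s (.plam (.app loosen s.shift))) := by
  have refl_type {Δ : Ctx} (hΔ : Wf Δ) {t : Tm} (ht : HasTy Δ t onePlusNm)
      (ht' : HasTy Δ.dim t.shift onePlusNm) :
      HasTy Δ (.plam (.app loosen t.shift)) (.eq bridgeNm (.app loosen t) (.app loosen t)) := by
    have hi (r : Tm) : (Tm.app loosen t.shift).inst r = .app loosen t :=
      congrArg (Tm.app loosen) (shift_inst t r)
    refine .plam (A := bridgeNm) (app_loosen_type hΔ.dim ht') ?_ ?_ <;> rw [hi] <;>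
      exact .refl (app_loosen_type hΔ ht)
  have hi (r : Tm) : (Tm.pair s.shift (.plam (.app loosen s.shift.shift))).inst r =
      .pair s (.plam (.app loosen s.shift)) := by
    have h := shift_inst (.pair s (.plam (.app loosen s.shift))) r
    have h' : (Tm.pair s (.plam (.app loosen s.shift))).shift =
      .pair s.shift (.plam (.app loosen s.shift.shift)) :=
      congrArg (fun t => Tm.pair s.shift (.plam (.app loosen t))) (rename_upr_shift s)
    rwa [h'] at h
  have hb := app_loosen_type hΓ.tmOnePlusNm hs_tm
  have hr := refl_type hΓ hs hs₁
  refine plam_eq_type ?_ ?_ ?_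
  · rw [fib_shift]
    exact pair_fib_type hΓ.dim (app_loosen_type hΓ.dim.tmOnePlusNm hs_dim_tm) hs₁
      (refl_type hΓ.dim hs₁ hs₂)
  · rw [hi]
    exact .symm (pair_fib_congr hΓ hb e (.conv e' (eqBridgeNm_congr hΓ
      (.symm (app_loosen_congr hΓ e)) (.refl (app_loosen_type hΓ hs)))))
  · rw [hi]
    exact .refl (pair_fib_type hΓ hb hs hr)

/-- `counit (loosen s)` is constant if `loosen s` equals a bridge `c` at which `counit` is. -/
theorem counit_loosen (hΓ : Wf Γ) {s c : Tm} (hs : HasTy Γ s onePlusNm)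
    (e : EqTm Γ (.app loosen s) c bridgeNm)
    (e₁ : EqTm Γ.dim (.app loosen s.shift) c.shift bridgeNm)
    (ec : EqTm Γ (.app counit c) (.plam c.shift) (.eq bridgeNm c c))
    (et : EqTm Γ (.app tighten (.app loosen s)) s onePlusNm) :
    EqTm Γ (.app counit (.app loosen s)) (.plam (.app loosen s.shift))
      (.eq bridgeNm (.app loosen s) (.app loosen s)) := by
  have hi (r : Tm) : (Tm.app loosen s.shift).inst r = .app loosen s :=
    congrArg (Tm.app loosen) (shift_inst s r)
  refine .trans (b := .app counit c) (.conv (app_counit_congr hΓ e) (eqBridgeNm_congr hΓ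
    (app_loosen_congr hΓ et) (.refl (app_loosen_type hΓ hs)))) ?_
  refine .conv (.trans ec (.symm ?_)) (eqBridgeNm_congr hΓ (.symm e) (.symm e))
  refine .plam (A := bridgeNm) e₁ ?_ ?_ <;> rw [hi] <;> exact e

theorem contr_refl_inl (hΓ : Wf Γ) {k : ℕ} (hk : Γ.vars[k]? = some (.tm .unit)) :
    HasTy Γ (.plam (.pair (.inl (.var (k + 1))) (.plam (.app loosen (.inl (.var (k + 2)))))))
      (contrTy (.app loosen (.inl (.var k))) (.inl (.var k))
        (.plam (.app loosen (.inl (.var (k + 1)))))) := by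
  have hs {Δ : Ctx} (hΔ : Wf Δ) {j : ℕ} (hj : Δ.vars[j]? = some (.tm .unit)) :
      HasTy Δ (.inl (.var j)) onePlusNm := .inl (.var' hΔ hj) (.Nm (l := 0) hΔ)
  have e := tighten_loosen_inl hΓ (.var' hΓ hk)
  have e₁ : HasTy Γ.dim (.var (k + 1)) .unit := .var' hΓ.dim hk
  exact contr_refl_type (s := .inl (.var k)) hΓ (hs hΓ hk) (hs hΓ.dim hk) (hs hΓ.dim.dim hk)
    (hs hΓ.tmOnePlusNm hk) (hs hΓ.dim.tmOnePlusNm hk) e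
    (counit_loosen hΓ (hs hΓ hk) (loosen_inl hΓ (.var' hΓ hk)) (loosen_inl hΓ.dim e₁)
      (counit_blam_cart hΓ) e)

theorem contr_refl_inr (hΓ : Wf Γ) {k : ℕ} (hk : Γ.vars[k]? = some (.tm .Nm)) :
    HasTy Γ (.plam (.pair (.inr (.var (k + 1))) (.plam (.app loosen (.inr (.var (k + 2)))))))
      (contrTy (.app loosen (.inr (.var k))) (.inr (.var k))
        (.plam (.app loosen (.inr (.var (k + 1)))))) := by
  have hs {Δ : Ctx} (hΔ : Wf Δ) {j : ℕ} (hj : Δ.vars[j]? = some (.tm .Nm)) :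
      HasTy Δ (.inr (.var j)) onePlusNm := .inr (.unit (l := 0) hΔ) (.var' hΔ hj)
  have e := tighten_loosen_inr hΓ hk
  have e₁ : HasTy Γ.dim (.var (k + 1)) .Nm := .var' hΓ.dim hk
  exact contr_refl_type (s := .inr (.var k)) hΓ (hs hΓ hk) (hs hΓ.dim hk) (hs hΓ.dim.dim hk)
    (hs hΓ.tmOnePlusNm hk) (hs hΓ.dim.tmOnePlusNm hk) e
    (counit_loosen hΓ (hs hΓ hk) (loosen_inr hΓ (.var' hΓ hk)) (loosen_inr hΓ.dim e₁)
      (counit_blam_var hΓ hk) e)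

/-- The path from the center of the fiber over `loosen s` to `(s, refl)`, as a closed term: a
constant path, after case analysis on `s`. -/
def contrRefl : Tm :=
  .lam (.case (.var 0)
    (.plam (.pair (.inl (.var 1)) (.plam (.app loosen (.inl (.var 2))))))
    (.plam (.pair (.inr (.var 1)) (.plam (.app loosen (.inr (.var 2)))))))

theorem loosen_refl_type (hΓ : Wf Γ) {k : ℕ} (hk : Γ.vars[k]? = some (.tm onePlusNm)) :
    HasTy Γ (.plam (.app loosen (.var (k + 1))))
      (.eq bridgeNm (.app loosen (.var k)) (.app loosen (.var k))) :=
  .plam (A := bridgeNm) (base_loosen_var hΓ hk).ty_dim (.refl (base_loosen_var hΓ hk).ty)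
    (.refl (base_loosen_var hΓ hk).ty)

theorem contrRefl_type (hΓ : Wf Γ) :
    HasTy Γ contrRefl (.pi onePlusNm
      (contrTy (.app loosen (.var 0)) (.var 0) (.plam (.app loosen (.var 1))))) := by
  have h := hΓ.tmOnePlusNm
  have h' := h.tmOnePlusNm
  exact .lam (onePlusNm_type (l := 0) hΓ) (.case (l := 0)
    (C := contrTy (.app loosen (.var 0)) (.var 0) (.plam (.app loosen (.var 1))))
    (A := .unit) (B := .Nm) (.var' h rfl)
    (contrTy_type h' (base_loosen_var h' rfl) (.var' h' rfl) (loosen_refl_type h' rfl))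
    (contr_refl_inl h.tmUnit rfl) (contr_refl_inr h.tmNm rfl))

theorem subst_conn (σ : ℕ → Tm) : conn.subst σ = conn :=
  congrArg (fun t => Tm.lam (.lam (.lam (.plam (.plam t)))))
    (subst_connTm (σ := ups (ups (ups (ups (ups σ))))) rfl rfl rfl rfl rfl rfl)

/-- `conn (loosen s) b p` at `r`, for the variables `s, b, p` of indices `p + 2, p + 1, p`. -/
def connApp (p : ℕ) (r : Tm) : Tm :=
  .papp (.app (.app (.app conn (.app loosen (.var (p + 2)))) (.var (p + 1))) (.var p)) r

/-- The variables `p + 2, p + 1, p` are `s : 1 + Nm`, `b : 𝔸 ⊸ Nm` and a path `loosen s ≡ b`. -/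
structure HasFibVar (Γ : Ctx) (p : ℕ) : Prop where
  fst : Γ.vars[p + 2]? = some (.tm onePlusNm)
  snd : Γ.vars[p + 1]? = some (.tm bridgeNm)
  path : Γ.vars[p]? = some (.tm (.eq bridgeNm (.app loosen (.var 1)) (.var 0)))

theorem HasFibVar.snoc {p : ℕ} (h : HasFibVar Γ p) (e : Entry) :
    HasFibVar (Γ.snoc e) (p + 1) :=
  ⟨h.fst, h.snd, h.path⟩

theorem HasFibVar.path_type {p : ℕ} (hp : HasFibVar Γ p) (hΓ : Wf Γ) :
    HasTy Γ (.var p) (.eq bridgeNm (.app loosen (.var (p + 2))) (.var (p + 1))) := by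
  refine .var' hΓ hp.path ?_
  have e : rename (fun m => m + (p + 1)) (.eq bridgeNm (.app loosen (.var 1)) (.var 0)) =
    .eq bridgeNm (.app loosen (.var (1 + (p + 1)))) (.var (0 + (p + 1))) := rfl
  rw [e, Nat.add_comm 1, Nat.zero_add]

theorem HasFibVar.base {p : ℕ} (hp : HasFibVar Γ p) (hΓ : Wf Γ) {r : Tm} (hr : IsDim Γ r) :
    Base Γ (.papp (.var p) r) :=
  ⟨papp_eq_type (hp.path_type hΓ) hr,
    papp_eq_type ((hp.snoc _).path_type hΓ.tmOnePlusNm) (hr.shift _),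
    papp_eq_type ((hp.snoc _).path_type hΓ.dim) (hr.shift _),
    papp_eq_type (((hp.snoc _).snoc _).path_type hΓ.dim.tmOnePlusNm) ((hr.shift _).shift _)⟩

theorem HasFibVar.base_i0 {p : ℕ} (hp : HasFibVar Γ p) (hΓ : Wf Γ) :
    BaseEq Γ (.app loosen (.var (p + 2))) (.papp (.var p) .i0) :=
  ⟨.symm (papp_eq_i0 (hp.path_type hΓ)),
    .symm (papp_eq_i0 ((hp.snoc _).path_type hΓ.tmOnePlusNm)),
    .symm (papp_eq_i0 (((hp.snoc _).snoc _).path_type hΓ.dim.tmOnePlusNm))⟩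

theorem HasFibVar.base_i1 {p : ℕ} (hp : HasFibVar Γ p) (hΓ : Wf Γ) :
    BaseEq Γ (.papp (.var p) .i1) (.var (p + 1)) :=
  ⟨papp_eq_i1 (hp.path_type hΓ), papp_eq_i1 ((hp.snoc _).path_type hΓ.tmOnePlusNm),
    papp_eq_i1 (((hp.snoc _).snoc _).path_type hΓ.dim.tmOnePlusNm)⟩

theorem conn_app_type (hΓ : Wf Γ) {p : ℕ} (hp : HasFibVar Γ p) :
    HasTy Γ (.app (.app (.app conn (.app loosen (.var (p + 2)))) (.var (p + 1))) (.var p))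
      (.path (.eq bridgeNm (.app loosen (.var (p + 3))) (.papp (.var (p + 1)) (.var 0)))
        (.plam (.app loosen (.var (p + 3)))) (.var p)) :=
  .app' (.app' (.app' (conn_type hΓ) (base_loosen_var hΓ hp.fst).ty) (.var' hΓ hp.snd))
    (hp.path_type hΓ)

/-- The contraction `Π s b (p : loosen s ≡ b), center b ≡ (s, p)`: coercion of `contrRefl s` along
the line `i ↦ (center (p i) ≡ (s, conn p i))`, where `conn p i` is the part of `p` up to `i`. -/
def contr : Tm :=
  .lam (.lam (.lam (.coe (contrTy (.papp (.var 1) (.var 0)) (.var 3) (connApp 1 (.var 0)))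
    .i0 .i1 (.app contrRefl (.var 2)))))

theorem contr_type (hΓ : Wf Γ) :
    HasTy Γ contr (.pi onePlusNm (.pi bridgeNm (.pi
      (.eq bridgeNm (.app loosen (.var 1)) (.var 0)) (contrTy (.var 1) (.var 2) (.var 0))))) := by
  have h₁ := hΓ.tmOnePlusNm.tmBridgeNm
  have hE := eqBridgeNm_type (l := 0) h₁ (base_loosen_var h₁ (k := 1) rfl).ty
    (base_var h₁ (k := 0) rfl).ty
  have h := h₁.tm hE
  have hp : HasFibVar (((Γ.tm onePlusNm).tm bridgeNm).tm
    (.eq bridgeNm (.app loosen (.var 1)) (.var 0))) 0 := ⟨rfl, rfl, rfl⟩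
  have hc := conn_app_type h hp
  -- `connApp 0 r` is what `r` substituted for the dimension yields: `conn` is closed.
  have hline₀ : (contrTy (.papp (.var 1) (.var 0)) (.var 3) (connApp 1 (.var 0))).inst .i0 =
      contrTy (.papp (.var 0) .i0) (.var 2) (connApp 0 .i0) :=
    congrArg (fun t => contrTy (.papp (.var 0) .i0) (.var 2)
      (.papp (.app (.app (.app t (.app loosen (.var 2))) (.var 1)) (.var 0)) .i0))
      (subst_conn (scons .i0 var))
  have hline₁ : (contrTy (.papp (.var 1) (.var 0)) (.var 3) (connApp 1 (.var 0))).inst .i1 =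
      contrTy (.papp (.var 0) .i1) (.var 2) (connApp 0 .i1) :=
    congrArg (fun t => contrTy (.papp (.var 0) .i1) (.var 2)
      (.papp (.app (.app (.app t (.app loosen (.var 2))) (.var 1)) (.var 0)) .i1))
      (subst_conn (scons .i1 var))
  have hs := base_loosen_var h (k := 2) rfl
  have hs2 : HasTy (((Γ.tm onePlusNm).tm bridgeNm).tm
    (.eq bridgeNm (.app loosen (.var 1)) (.var 0))) (.var 2) onePlusNm := .var' h rfl
  refine .lam (onePlusNm_type (l := 0) hΓ) (.lam (bridgeNm_type (l := 0) hΓ.tmOnePlusNm)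
    (.lam hE ?_))
  have hL : HasTy (((Γ.tm onePlusNm).tm bridgeNm).tm
      (.eq bridgeNm (.app loosen (.var 1)) (.var 0))).dim
      (contrTy (.papp (.var 1) (.var 0)) (.var 3) (connApp 1 (.var 0))) (.univ 0) :=
    contrTy_type h.dim ((hp.snoc _).base h.dim (.var rfl)) (.var' h.dim rfl)
      (.papp (conn_app_type h.dim (hp.snoc _)) (.var rfl))
  have h0 : EqTm _ (contrTy (.app loosen (.var 2)) (.var 2) (.plam (.app loosen (.var 3))))
      (contrTy (.papp (.var 0) .i0) (.var 2) (connApp 0 .i0)) (.univ 0) :=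
    contrTy_congr h hs (hp.base_i0 h) hs2 (.symm (.conv (.papp_i0 hc)
      (eqBridgeNm_congr h (.refl hs.ty) (.symm (hp.base_i0 h).eq))))
  have h1 : EqTm _ (contrTy (.papp (.var 0) .i1) (.var 2) (connApp 0 .i1))
      (contrTy (.var 1) (.var 2) (.var 0)) (.univ 0) :=
    contrTy_congr h (hp.base h .i1) (hp.base_i1 h) hs2 (.papp_i1 hc)
  have hm := HasTy.app'
    (T := contrTy (.app loosen (.var 2)) (.var 2) (.plam (.app loosen (.var 3))))
    (contrRefl_type h) hs2
  refine .conv (?_ : HasTy _ _ (contrTy (.papp (.var 0) .i1) (.var 2) (connApp 0 .i1))) h1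
  rw [← hline₁]
  exact .coe hL .i0 .i1 (by rw [hline₀]; exact .conv hm h0)

/-! ### The equivalence underlying `loosen` -/

theorem isContr_type {X : Tm} {l : ℕ} (h : Wf Γ) (hX : HasTy Γ X (.univ l))
    (hX₁ : HasTy (Γ.tm X) X.shift (.univ l))
    (hX₂ : HasTy ((Γ.tm X).tm X.shift).dim X.shift.shift.shift (.univ l)) :
    HasTy Γ (.isContr X) (.univ l) := by
  have h' := (h.tm hX).tm hX₁
  refine .sigma hX (.pi hX₁ (eq_type hX₂ (.var' h' rfl ?_) (.var' h' rfl)))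
  exact (rename_rename X _ _).symm

/-- Here `f n` is the weakening of `f 0` by `n` entries, typed in any extension of `Γ` by `n`
entries. -/
theorem isEquiv_type (hΓ : Wf Γ) {f : ℕ → Tm} {l : ℕ} (hf : ∀ n, (f n).shift = f (n + 1))
    (hty : ∀ {Δ : Ctx} (L : List Entry), Wf Δ → Δ.vars = L ++ Γ.vars →
      HasTy Δ (f L.length) (.arrow onePlusNm bridgeNm)) :
    HasTy Γ (.isEquiv onePlusNm bridgeNm (f 0)) (.univ l) := by
  have hs (n k : ℕ) : (Tm.fiber onePlusNm bridgeNm (f n) (.var k)).shift =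
      .fiber onePlusNm bridgeNm (f (n + 1)) (.var (k + 1)) := by
    rw [← hf]
    exact congrArg (fun t => Tm.sigma onePlusNm (.path bridgeNm (.app t (.var 0)) (.var (k + 2))))
      (rename_upr_shift (f n))
  have key {Δ : Ctx} (L : List Entry) (hΔ : Wf Δ) (e : Δ.vars = L ++ Γ.vars) {k l : ℕ}
      (hk : Δ.vars[k]? = some (.tm bridgeNm)) :
      HasTy Δ (.fiber onePlusNm bridgeNm (f L.length) (.var k)) (.univ l) :=
    fiber_type hΔ (hf _ ▸ hty (.tm onePlusNm :: L) hΔ.tmOnePlusNm (congrArg _ e))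
      (.var' hΔ.tmOnePlusNm hk)
  have h := hΓ.tmBridgeNm
  have h₁ := key (l := l) [.tm bridgeNm] h rfl (k := 0) rfl
  have h₂ := key (l := l) [_, .tm bridgeNm] (h.tm h₁) rfl (k := 1) rfl
  have h₃ := key (l := l) [.dim, _, _, .tm bridgeNm] ((h.tm h₁).tm h₂).dim rfl (k := 3) rfl
  refine .pi (bridgeNm_type hΓ) ?_
  show HasTy _ (.isContr (.fiber onePlusNm bridgeNm (f 0).shift (.var 0))) _
  rw [hf]
  refine isContr_type h h₁ ?_ ?_
  · rw [hs]; exact h₂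
  · rw [hs, hs, hs]; exact h₃

theorem isEquiv_var_type (hΓ : Wf Γ) {k l : ℕ}
    (hk : Γ.vars[k]? = some (.tm (.arrow onePlusNm bridgeNm))) :
    HasTy Γ (.isEquiv onePlusNm bridgeNm (.var k)) (.univ l) := by
  have h := isEquiv_type hΓ (f := fun n => .var (k + n)) (l := l) (fun n => rfl)
    fun {Δ} L hΔ e => .var' hΔ (A := .arrow onePlusNm bridgeNm) (by
      rw [e, List.getElem?_append_right (Nat.le_add_left ..), Nat.add_sub_cancel]; exact hk)
  exact h

/-- The proof that `loosen` has contractible fibers. -/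
def loosenIsEquiv : Tm :=
  .lam (.pair (center (.var 0))
    (.lam (.app (.app (.app contr (.fst (.var 0))) (.var 1)) (.snd (.var 0)))))

theorem loosenIsEquiv_type (hΓ : Wf Γ) :
    HasTy Γ loosenIsEquiv (.isEquiv onePlusNm bridgeNm loosen) := by
  have h := hΓ.tmBridgeNm
  have hb := base_var h (k := 0) rfl
  have hX : HasTy (Γ.tm bridgeNm) (fib (.var 0)) (.univ 0) := fib_type h hb.ty_tm
  have h' := h.tm hX
  have hb' := base_var h' (k := 1) rfl
  have hX' : HasTy ((Γ.tm bridgeNm).tm (fib (.var 0))) (fib (.var 1)) (.univ 0) :=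
    fib_type h' hb'.ty_tm
  have h'' := h'.tm hX'
  have hb'' := base_var h''.dim (k := 3) rfl
  have hz : HasTy ((Γ.tm bridgeNm).tm (fib (.var 0))) (.var 0) (fib (.var 1)) := .var' h' rfl
  have hz₁ := HasTy.fst hz
  have hz₂ : HasTy _ (.snd (.var 0))
    (.eq bridgeNm (.app loosen (.fst (.var 0))) (.var 1)) := .snd hz
  have hsnd := fiber_snd_type (f := loosen) (l := 0) h' (loosen_type h'.tmOnePlusNm) hb'.ty_tm
  have hpair := pair_fib_type h' hb'.ty_tm hz₁ hz₂
  refine .lam (bridgeNm_type (l := 0) hΓ) (.pair (l := 0) hX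
    (.pi hX' (eq_type (A := fib (.var 2)) (fib_type h''.dim hb''.ty_tm)
      (.var' h'' rfl) (.var' h'' rfl)))
    (center_type h hb.ty hb.ty_tm) (.lam hX ?_))
  have hc : HasTy _ (.app (.app (.app contr (.fst (.var 0))) (.var 1)) (.snd (.var 0)))
      (contrTy (.var 1) (.fst (.var 0)) (.snd (.var 0))) :=
    .app' (.app' (.app' (contr_type h') hz₁) hb'.ty) hz₂
  have e₁ := EqTm.fst_beta hsnd hz₁ hz₂
  have e₂ : EqTm _ (.snd (.pair (.fst (.var 0)) (.snd (.var 0)))) (.snd (.var 0))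
      (.eq bridgeNm (.app loosen (.fst (.pair (.fst (.var 0)) (.snd (.var 0))))) (.var 1)) :=
    .conv (.snd_beta hsnd hz₁ hz₂)
      (eqBridgeNm_congr h' (app_loosen_congr h' (.symm e₁)) (.refl hb'.ty))
  exact .conv (l := 0) hc (eq_congr (.refl (fib_type h'.dim hb'.ty_dim_tm))
    (.refl (center_type h' hb'.ty hb'.ty_tm))
    (.sigma_eta hpair hz e₁ e₂))

theorem equiv_type (hΓ : Wf Γ) :
    HasTy Γ (.pair loosen loosenIsEquiv) (.equiv onePlusNm bridgeNm) := by
  have hA : HasTy Γ (.arrow onePlusNm bridgeNm) (.univ 0) :=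
    .pi (onePlusNm_type hΓ) (bridgeNm_type hΓ.tmOnePlusNm)
  exact .pair hA (isEquiv_var_type (hΓ.tm hA) (k := 0) rfl) (loosen_type hΓ)
    (loosenIsEquiv_type hΓ)

end NullaryPTT

theorem mainTheorem1 :
    NullaryPTT.HasTy .empty NullaryPTT.loosen
      (.arrow NullaryPTT.onePlusNm NullaryPTT.bridgeNm) ∧
    NullaryPTT.HasTy .empty NullaryPTT.tighten
      (.arrow NullaryPTT.bridgeNm NullaryPTT.onePlusNm) ∧
    -- `Π (s : 1 + Nm), tighten (loosen s) ≡ s`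
    (∃ η, NullaryPTT.HasTy .empty η
      (.pi NullaryPTT.onePlusNm (.eq NullaryPTT.onePlusNm
        (.app NullaryPTT.tighten (.app NullaryPTT.loosen (.var 0))) (.var 0)))) ∧
    -- `Π (n' : 𝔸 ⊸ Nm), loosen (tighten n') ≡ n'`
    (∃ ε, NullaryPTT.HasTy .empty ε
      (.pi NullaryPTT.bridgeNm (.eq NullaryPTT.bridgeNm
        (.app NullaryPTT.loosen (.app NullaryPTT.tighten (.var 0))) (.var 0)))) ∧
    -- `loosen` underlies an equivalence `1 + Nm ≃ (𝔸 ⊸ Nm)`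
    (∃ h, NullaryPTT.HasTy .empty (.pair NullaryPTT.loosen h)
      (.equiv NullaryPTT.onePlusNm NullaryPTT.bridgeNm)) ∧
    -- `Π (n' : 𝔸 ⊸ Nm), ((λ x. c x) ≡ n') + (Σ (n : Nm), (λ _. n) ≡ n')`
    (∃ d, NullaryPTT.HasTy .empty d
      (.pi NullaryPTT.bridgeNm (.sum
        (.eq NullaryPTT.bridgeNm (.blam (.cart (.var 0))) (.var 0))
        (.sigma .Nm (.eq NullaryPTT.bridgeNm (.blam (.var 1)) (.var 1)))))) := by
  have h := NullaryPTT.Wf.empty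
  exact ⟨NullaryPTT.loosen_type h, NullaryPTT.tighten_type h, ⟨_, NullaryPTT.unitPath_type h⟩,
    ⟨_, NullaryPTT.counit_type h⟩, ⟨_, NullaryPTT.equiv_type h⟩, ⟨_, NullaryPTT.decomp_type h⟩⟩
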